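/- **The graphs.** For positive integers $n,r,s,t$ let $G_{n,r,s,t}=(V,E,c)$ be the following weighted directed multigraph, where $[m]=\{1,\dots,m\}$ and $\epsilon=1/(rs)$. The vertices are a target $\mathsf t$, the vertices $u_i,w_i$ ($i\in[n]$), $a_{i,j,k}$ ($i\in[n],j\in[r],k\in[s]$) and $b_{i,j}$ ($i\in[n],j\in[rs]$); put $u_{n+1}=w_{n+1}=\mathsf t$, $a_{i,j,s+1}=b_{i,1}$ and $b_{i,rs+1}=w_{i+1}$. For all $i\in[n]$ the edges are: - $a_{i,j,k}\to a_{i,j,k+1}$ of cost $0$, and $t$ copies of the *zero-edge* $a_{i,j,k}\to u_{i+1}$ of cost $2^{2i+1}+(k-1)\epsilon$ ($j\in[r]$, $k\in[s]$); - $b_{i,j}\to b_{i,j+1}$ of cost $0$, and $t$ copies of the zero-edge $b_{i,j}\to u_{i+1}$ of cost $2^{2i+1}+1+(j-1)\epsilon$ ($j\in[rs]$); - $t$ copies of $u_i\to b_{i,1}$ of cost $0$, and $t$ copies of the zero-edge $u_i\to u_{i+1}$ of cost $2^{2i}$; - $t$ copies of $w_i\to a_{i,j,1}$ of cost $0$ for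 every $j\in[r]$, and $t$ copies of the zero-edge $w_i\to w_{i+1}$ of cost $2^{2i}$. **The algorithm.** A *tree* is a set $B\subseteq E$ that contains exactly one edge leaving each vertex other than $\mathsf t$ and along which $\mathsf t$ is reached from every vertex; $y_B(v)$ is the cost of the path in $B$ from $v$ to $\mathsf t$. An edge $e=(u,v)$ is an *improving switch* with respect to $B$ if $c(e)+y_B(v)<y_B(u)$, and $B[e]$ is the tree obtained from $B$ by replacing the edge that leaves $u$ by $e$. Given an injective $\sigma:E\to\mathbb N$, a set $F\subseteq E$ and a tree $B\subseteq F$, $\text{Random-Facet}^{1P}(F,B,\sigma)$ returns $B$ if $F=B$. Otherwise it takes the edge $e\in F\setminus B$ with the smallest $\sigma(e)$ and lets $B'$ be the tree returned by $\text{Random-Facet}^{1P}(F\setminus\{e\},B,\sigma)$. If $e$ is an improving switch with respect to $B'$, it performs this switch and returns the result of $\text{Random-Facet}^{1P}(F,B'[e],\sigma)$; otherwise it returns $B'$. For a tree $B_0$ let $g(B_0)$ be the expected total number of improving switches performed by $\text{Random-Facet}^{1P}(E,B_0,\sigma)$ (including those of all recursive calls) when $\sigma$ is a uniformly random bijection $E\to\{1,\dots,|E|\}$.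 **Theorem.** Let $\rho:\mathbb N\to\mathbb N$ satisfy $\rho(n)=\Theta(\log n)$ and $\rho(n)\ge 3\lceil\log n\rceil$ for all large $n$ (natural logarithm; for instance $\rho(n)=3\lceil\log n\rceil$ or $\rho(n)=3\lceil\log_2 n\rceil$). Consider $G_{n,r,s,t}$ with $r=s=t=\rho(n)$, and let $M=M(n)$ be its number of edges. Then $\sqrt n=\Theta\big(\sqrt M/\log^{3/2}M\big)$, and there is a constant $c>0$ such that for all sufficiently large $n$ and every tree $B_0$ of $G_{n,r,s,t}$ that consists of zero-edges only, $$g(B_0)\ \ge\ e^{c\sqrt n}\qquad\text{and}\qquad g(B_0)\ \ge\ e^{c\sqrt M/\log^{3/2}M}.$$ That is, $g(B_0)$ is at least $e^{\Omega(\sqrt n)}=e^{\Omega(\sqrt M/\log^{3/2}M)}$. -/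

import Mathlib

/-- A weighted directed multigraph with vertices `V`, edges `E` and a distinguished target. -/
structure WeightedDigraph (V E : Type*) where
  src : E → V
  dst : E → V
  cost : E → ℝ
  target : V

namespace WeightedDigraph

variable {V E : Type*} (G : WeightedDigraph V E)

/-- `G.PathCost B v d`: the edges of `B` contain a directed path from `v` to the target whose
total cost is `d`. If `B` is a tree, then there is exactly one such `d`, the value `y_B(v)`. -/
inductive PathCost (B : Finset E) : V → ℝ → Prop
  | nil : PathCost B G.target 0
  | cons (e : E) (d : ℝ) (he : e ∈ B) (hd : PathCost B (G.dst e) d) :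
      PathCost B (G.src e) (G.cost e + d)

/-- A tree directed towards the target: exactly one edge leaves every vertex other than the
target, no edge leaves the target, and the target is reached from every vertex. -/
def IsTree (B : Finset E) : Prop :=
  (∀ v, v ≠ G.target → ∃! e, e ∈ B ∧ G.src e = v) ∧
  (∀ e ∈ B, G.src e ≠ G.target) ∧
  ∀ v, ∃ d, G.PathCost B v d

/-- The edge `e = (u, v)` is an improving switch with respect to the tree `B`:
`c(e) + y_B(v) < y_B(u)`. -/
def IsImprovingSwitch (B : Finset E) (e : E) : Prop :=
  ∃ d d' : ℝ, G.PathCost B (G.dst e) d ∧ G.PathCost B (G.src e) d' ∧ G.cost e + d < d'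

open Classical in
/-- The tree `B[e]`: the edge of `B` leaving the source of `e` is replaced by `e`. -/
noncomputable def switch (B : Finset E) (e : E) : Finset E :=
  insert e (B.filter fun e' => G.src e' ≠ G.src e)

/-- `e` is the edge of `F \ B` with the smallest permutation index. -/
def IsFirst (σ : E → ℕ) (F B : Finset E) (e : E) : Prop :=
  e ∈ F ∧ e ∉ B ∧ ∀ e' ∈ F, e' ∉ B → σ e ≤ σ e'

open Classical in
/-- The one-permutation variant of the Random-Facet algorithm. `G.RandomFacet1P σ F B B' k` says
that the call with edge set `F`, tree `B` and permutation function `σ` terminates, returns the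
tree `B'`, and performs exactly `k` improving switches.
* If `F = B`, then `B` is returned.
* Otherwise let `e` be the edge of `F \ B` with the smallest index. The call on `F \ {e}` and `B`
  returns a tree `B'`. If `e` is not an improving switch with respect to `B'`, then `B'` is
  returned; otherwise the switch is performed and the algorithm is called on `F` and `B'[e]`. -/
inductive RandomFacet1P (σ : E → ℕ) : Finset E → Finset E → Finset E → ℕ → Prop
  | done (B : Finset E) : RandomFacet1P σ B B B 0
  | stay (F B B' : Finset E) (e : E) (k : ℕ) (he : IsFirst σ F B e)
      (h₁ : RandomFacet1P σ (F.erase e) B B' k) (hn : ¬ G.IsImprovingSwitch B' e) :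
      RandomFacet1P σ F B B' k
  | step (F B B' B'' : Finset E) (e : E) (k₁ k₂ : ℕ) (he : IsFirst σ F B e)
      (h₁ : RandomFacet1P σ (F.erase e) B B' k₁) (hi : G.IsImprovingSwitch B' e)
      (h₂ : RandomFacet1P σ F (G.switch B' e) B'' k₂) :
      RandomFacet1P σ F B B'' (k₁ + 1 + k₂)

/-- The algorithm is deterministic once the permutation function is fixed. -/
theorem RandomFacet1P.unique {σ : E → ℕ} (hσ : Function.Injective σ) {F B B₁ B₂ : Finset E}
    {k₁ k₂ : ℕ} (h₁ : G.RandomFacet1P σ F B B₁ k₁) (h₂ : G.RandomFacet1P σ F B B₂ k₂) :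
    B₁ = B₂ ∧ k₁ = k₂ := by
  have key : ∀ {F B : Finset E} {e e' : E}, IsFirst σ F B e → IsFirst σ F B e' → e = e' :=
    fun h h' => hσ (le_antisymm (h.2.2 _ h'.1 h'.2.1) (h'.2.2 _ h.1 h.2.1))
  induction h₁ generalizing B₂ k₂ with
  | done B =>
    cases h₂ with
    | done => exact ⟨rfl, rfl⟩
    | stay _ _ _ e _ he => exact absurd he.1 he.2.1
    | step _ _ _ _ e _ _ he => exact absurd he.1 he.2.1
  | stay F B B' e k he h₁ hn ih =>
    cases h₂ with
    | done => exact absurd he.1 he.2.1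
    | stay _ _ _ e' _ he' h₁' hn' =>
      obtain rfl := key he he'
      exact ih h₁'
    | step _ _ B'' _ e' _ _ he' h₁' hi' h₂' =>
      obtain rfl := key he he'
      obtain ⟨rfl, rfl⟩ := ih h₁'
      exact absurd hi' hn
  | step F B B' B'' e k l he h₁ hi h₃ ih₁ ih₂ =>
    cases h₂ with
    | done => exact absurd he.1 he.2.1
    | stay _ _ _ e' _ he' h₁' hn' =>
      obtain rfl := key he he'
      obtain ⟨rfl, rfl⟩ := ih₁ h₁'
      exact absurd hi hn'
    | step _ _ B₃ _ e' _ _ he' h₁' hi' h₂' =>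
      obtain rfl := key he he'
      obtain ⟨rfl, rfl⟩ := ih₁ h₁'
      obtain ⟨rfl, rfl⟩ := ih₂ h₂'
      exact ⟨rfl, rfl⟩

open Classical in
/-- The number of improving switches performed by the call with arguments `F`, `B`, `σ`.
It is set to `0`, the worst value for a lower bound, should the call not terminate. -/
noncomputable def numSwitches (σ : E → ℕ) (F B : Finset E) : ℕ :=
  if h : ∃ k, ∃ B', G.RandomFacet1P σ F B B' k then h.choose else 0

open Classical in
/-- The expected number of improving switches performed by the one-permutation variant of
Random-Facet on the whole graph from the initial tree `B₀`, when the permutation function is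
uniformly random among all the bijections of the edge set with an initial segment of `ℕ`.
(The algorithm only compares the indices, so it is immaterial that they start at `0`.) -/
noncomputable def expectedSwitches [Fintype E] (B₀ : Finset E) : ℝ :=
  (∑ σ : E ≃ Fin (Fintype.card E), (G.numSwitches (fun e => (σ e : ℕ)) Finset.univ B₀ : ℝ)) /
    (Fintype.card (E ≃ Fin (Fintype.card E)) : ℝ)

end WeightedDigraph

/-! ### The graphs `G_{n,r,s,t}`

All indices are zero-based: `i : Fin n` stands for the level `i + 1`, and similarly for the
positions `j`, `k` and for the copies `ℓ : Fin t` of a multi-edge. -/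

/-- The vertices of `G_{n,r,s,t}`. -/
inductive LBVertex (n r s : ℕ) : Type
  | target : LBVertex n r s
  | u (i : Fin n) : LBVertex n r s
  | w (i : Fin n) : LBVertex n r s
  | a (i : Fin n) (j : Fin r) (k : Fin s) : LBVertex n r s
  | b (i : Fin n) (j : Fin (r * s)) : LBVertex n r s

/-- The edges of `G_{n,r,s,t}`, named as follows: `a1 i j k` is `a¹_{i,j,k}`, `a0 i j k ℓ` is
`a^{0,ℓ}_{i,j,k}`, `b1 i j` is `b¹_{i,j}`, `b0 i j ℓ` is `b^{0,ℓ}_{i,j}`, `u1 i ℓ` is `u^{1,ℓ}_i`,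
`u0 i ℓ` is `u^{0,ℓ}_i`, `w1 i j ℓ` is `w^{j,ℓ}_i`, and `w0 i ℓ` is `w^{0,ℓ}_i`. -/
inductive LBEdge (n r s t : ℕ) : Type
  | a1 (i : Fin n) (j : Fin r) (k : Fin s) : LBEdge n r s t
  | a0 (i : Fin n) (j : Fin r) (k : Fin s) (l : Fin t) : LBEdge n r s t
  | b1 (i : Fin n) (j : Fin (r * s)) : LBEdge n r s t
  | b0 (i : Fin n) (j : Fin (r * s)) (l : Fin t) : LBEdge n r s t
  | u1 (i : Fin n) (l : Fin t) : LBEdge n r s t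
  | u0 (i : Fin n) (l : Fin t) : LBEdge n r s t
  | w1 (i : Fin n) (j : Fin r) (l : Fin t) : LBEdge n r s t
  | w0 (i : Fin n) (l : Fin t) : LBEdge n r s t
  deriving DecidableEq, Fintype

namespace LBVertex

variable {n r s : ℕ}

/-- The vertex `u_{i+1}`, which is the target if `i` is the last level. -/
def uNext (i : Fin n) : LBVertex n r s :=
  if h : (i : ℕ) + 1 < n then u ⟨i + 1, h⟩ else target

/-- The vertex `w_{i+1}`, which is the target if `i` is the last level. -/
def wNext (i : Fin n) : LBVertex n r s :=
  if h : (i : ℕ) + 1 < n then w ⟨i + 1, h⟩ else target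

/-- The vertex in (zero-based) position `j` of the `b`-path of level `i`, or `w_{i+1}` past the end
of the path. In particular `bAt i 0` is `b_{i,1}` whenever `r` and `s` are positive. -/
def bAt (i : Fin n) (j : ℕ) : LBVertex n r s :=
  if h : j < r * s then b i ⟨j, h⟩ else wNext i

/-- The vertex in (zero-based) position `k` of the `j`-th `a`-path of level `i`, or `b_{i,1}` past
the end of the path. -/
def aAt (i : Fin n) (j : Fin r) (k : ℕ) : LBVertex n r s :=
  if h : k < s then a i j ⟨k, h⟩ else bAt i 0

end LBVertex

namespace LBEdge

variable {n r s t : ℕ}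

/-- The vertex that an edge leaves. -/
def src : LBEdge n r s t → LBVertex n r s
  | a1 i j k => .a i j k
  | a0 i j k _ => .a i j k
  | b1 i j => .b i j
  | b0 i j _ => .b i j
  | u1 i _ => .u i
  | u0 i _ => .u i
  | w1 i _ _ => .w i
  | w0 i _ => .w i

/-- The vertex that an edge enters. -/
def dst : LBEdge n r s t → LBVertex n r s
  | a1 i j k => .aAt i j (k + 1)
  | a0 i _ _ _ => .uNext i
  | b1 i j => .bAt i (j + 1)
  | b0 i _ _ => .uNext i
  | u1 i _ => .bAt i 0
  | u0 i _ => .uNext i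
  | w1 i j _ => .aAt i j 0
  | w0 i _ => .wNext i

/-- The cost of an edge, with `ε = 1 / (r s)`. As `i`, `j`, `k` are zero-based, the factors
`j - 1` and `k - 1` of the one-based convention appear as `j` and `k`, and `2^{2i}`, `2^{2i+1}`
appear as `2^{2(i+1)}`, `2^{2(i+1)+1}`. -/
noncomputable def cost : LBEdge n r s t → ℝ
  | a1 _ _ _ => 0
  | a0 i _ k _ => 2 ^ (2 * ((i : ℕ) + 1) + 1) + (k : ℕ) * (1 / ((r : ℝ) * s))
  | b1 _ _ => 0
  | b0 i j _ => 2 ^ (2 * ((i : ℕ) + 1) + 1) + 1 + (j : ℕ) * (1 / ((r : ℝ) * s))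
  | u1 _ _ => 0
  | u0 i _ => 2 ^ (2 * ((i : ℕ) + 1))
  | w1 _ _ _ => 0
  | w0 i _ => 2 ^ (2 * ((i : ℕ) + 1))

/-- The zero-edges, i.e. the edges whose name has the superscript `0`. -/
def IsZeroEdge : LBEdge n r s t → Prop
  | a0 _ _ _ _ => True
  | b0 _ _ _ => True
  | u0 _ _ => True
  | w0 _ _ => True
  | _ => False

end LBEdge

/-- The graph `G_{n,r,s,t}`. -/
noncomputable def lbGraph (n r s t : ℕ) : WeightedDigraph (LBVertex n r s) (LBEdge n r s t) where
  src := LBEdge.src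
  dst := LBEdge.dst
  cost := LBEdge.cost
  target := LBVertex.target

/-- The number `M` of edges of `G_{n,r,s,t}`. -/
def lbNumEdges (n r s t : ℕ) : ℕ := Fintype.card (LBEdge n r s t)

open Filter Asymptotics

/-! Each level is a bit of a randomized counter, set when the tree uses the whole `b`-path of the
level. If `u` and `w` have equal values on the next level, a set bit with a complete `a`-path gives
both `u_i` and `w_i` the value of the next level, and an unset bit adds `levelCost i` to both
(`y_u_eq_y_w_of_next`).

The recursion removes edges in order of increasing index and brings them back in the reverse order,
so a bit is set when the edge of its `b`-path with the smallest index returns; `completion` is this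
index. At that moment the `a`-paths of the level `l` in question are still unused, because they do
not pay while the `b`-path is broken. The next call therefore starts removing edges again, until no
`a`-path of level `l` is complete. Then `u_l` profits from the set bit and `w_l` does not, so `w` is
much more expensive than `u` on all lower levels (`levelCost_le_gap`) and the optimal tree leaves
every lower `b`-path (`b1_not_mem_of_reset`): the lower bits are reset. When the removed `a`-edge
returns, a call starts that counts afresh with the levels below `l` (`exists_ready_of_pending`).

Hence, if `N` is the set of active levels and `l` has the smallest completion index in `N`, the work
for `N` includes the work for `N \ {l}` and the work for the levels of `N` below `l`. The number of
subsets of `N` along which the completion index decreases obeys this recursion as an upper bound, so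
it is at most one plus the number of switches (`card_antitoneSets_le_of_ready`).

This requires thresholds `z ≤ h` that make `b`-paths break before one `a`-path per level, and
`a`-paths break before all copies of a multi-edge are gone (`WellOrdered`). A union bound shows that
this fails with probability at most 1/2. By symmetry between levels, the expected number of
decreasing `k`-sets is at least `n.choose k / k!` times the probability of `WellOrdered`; the choice
of `k` near `√n / 2` gives `exp (√n / 4)`. -/

namespace WeightedDigraph

variable {V E : Type*} {G : WeightedDigraph V E} {B F : Finset E}

/-! ### Values of trees -/

theorem PathCost.inv {v : V} {d : ℝ} (h : G.PathCost B v d) :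
    (v = G.target ∧ d = 0) ∨
      ∃ e ∈ B, G.src e = v ∧ ∃ d', G.PathCost B (G.dst e) d' ∧ d = G.cost e + d' := by
  cases h with
  | nil => exact Or.inl ⟨rfl, rfl⟩
  | cons e d he hd => exact Or.inr ⟨e, he, rfl, d, hd, rfl⟩

theorem IsTree.pathCost_unique (hB : G.IsTree B) {v : V} {d d' : ℝ}
    (h : G.PathCost B v d) (h' : G.PathCost B v d') : d = d' := by
  induction h generalizing d' with
  | nil =>
    rcases h'.inv with ⟨-, rfl⟩ | ⟨e, he, hs, -⟩
    · rfl
    · exact absurd hs (hB.2.1 e he)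
  | cons e d he hd ih =>
    rcases h'.inv with ⟨hs, -⟩ | ⟨e', he', hs, d'', hd'', rfl⟩
    · exact absurd hs (hB.2.1 e he)
    · obtain rfl : e' = e := (hB.1 _ (hB.2.1 e he)).unique ⟨he', hs⟩ ⟨he, rfl⟩
      rw [ih hd'']

variable (G) in
open Classical in
/-- The value `y_B(v)` of a vertex in a tree. -/
noncomputable def val (B : Finset E) (v : V) : ℝ :=
  if h : ∃ d, G.PathCost B v d then h.choose else 0

theorem IsTree.pathCost_val (hB : G.IsTree B) (v : V) : G.PathCost B v (G.val B v) := by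
  have h := hB.2.2 v
  rw [val, dif_pos h]
  exact h.choose_spec

theorem IsTree.val_target (hB : G.IsTree B) : G.val B G.target = 0 :=
  hB.pathCost_unique (hB.pathCost_val _) PathCost.nil

theorem IsTree.val_src (hB : G.IsTree B) {e : E} (he : e ∈ B) :
    G.val B (G.src e) = G.cost e + G.val B (G.dst e) :=
  hB.pathCost_unique (hB.pathCost_val _) (PathCost.cons e _ he (hB.pathCost_val _))

theorem IsTree.isImprovingSwitch_iff (hB : G.IsTree B) {e : E} :
    G.IsImprovingSwitch B e ↔ G.cost e + G.val B (G.dst e) < G.val B (G.src e) := by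
  constructor
  · rintro ⟨d, d', hd, hd', h⟩
    rwa [hB.pathCost_unique (hB.pathCost_val _) hd, hB.pathCost_unique (hB.pathCost_val _) hd']
  · exact fun h => ⟨_, _, hB.pathCost_val _, hB.pathCost_val _, h⟩

/-- A rank function that decreases along all edges; the target has no outgoing edge. -/
structure IsRanking (G : WeightedDigraph V E) (rk : V → ℕ) : Prop where
  lt : ∀ e, rk (G.dst e) < rk (G.src e)
  src_ne : ∀ e, G.src e ≠ G.target

variable {rk : V → ℕ}

/-- In an acyclic graph, following outgoing edges always ends at the target, so reachability is
automatic. -/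
theorem IsRanking.isTree (hG : G.IsRanking rk)
    (h : ∀ v, v ≠ G.target → ∃! e, e ∈ B ∧ G.src e = v) : G.IsTree B := by
  refine ⟨h, fun e _ => hG.src_ne e, fun v => ?_⟩
  induction hk : rk v using Nat.strong_induction_on generalizing v with
  | _ k ih =>
    by_cases hv : v = G.target
    · exact ⟨0, hv ▸ PathCost.nil⟩
    · obtain ⟨e, ⟨he, rfl⟩, -⟩ := h v hv
      obtain ⟨d, hd⟩ := ih _ (hk ▸ hG.lt e) _ rfl
      exact ⟨_, PathCost.cons e d he hd⟩

theorem mem_switch {e e' : E} : e' ∈ G.switch B e ↔ e' = e ∨ e' ∈ B ∧ G.src e' ≠ G.src e := by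
  simp [switch]

theorem IsTree.switch (hB : G.IsTree B) (hG : G.IsRanking rk) (e : E) :
    G.IsTree (G.switch B e) := by
  refine hG.isTree fun v hv => ?_
  by_cases h : G.src e = v
  · refine ⟨e, ⟨mem_switch.2 (Or.inl rfl), h⟩, ?_⟩
    rintro e' ⟨he', hs⟩
    rcases mem_switch.1 he' with rfl | ⟨-, hne⟩
    · rfl
    · exact absurd (hs.trans h.symm) hne
  · obtain ⟨e₀, ⟨he₀, hs₀⟩, hu⟩ := hB.1 v hv
    refine ⟨e₀, ⟨mem_switch.2 (Or.inr ⟨he₀, fun h' => h (h'.symm.trans hs₀)⟩), hs₀⟩, ?_⟩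
    rintro e' ⟨he', hs⟩
    rcases mem_switch.1 he' with rfl | ⟨hm, -⟩
    · exact absurd hs h
    · exact hu e' ⟨hm, hs⟩

theorem IsTree.val_switch_le (hB : G.IsTree B) (hG : G.IsRanking rk) {e : E}
    (he : G.IsImprovingSwitch B e) (v : V) : G.val (G.switch B e) v ≤ G.val B v := by
  have hB' := hB.switch hG e
  rw [hB.isImprovingSwitch_iff] at he
  induction hk : rk v using Nat.strong_induction_on generalizing v with
  | _ k ih =>
    by_cases hv : v = G.target
    · rw [hv, hB.val_target, hB'.val_target]
    · obtain ⟨f, ⟨hf, rfl⟩, -⟩ := hB'.1 v hv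
      have := ih _ (hk ▸ hG.lt f) _ rfl
      rw [hB'.val_src hf]
      rcases mem_switch.1 hf with rfl | ⟨hm, -⟩
      · linarith
      · rw [hB.val_src hm]; linarith

theorem IsTree.val_switch_lt (hB : G.IsTree B) (hG : G.IsRanking rk) {e : E}
    (he : G.IsImprovingSwitch B e) : G.val (G.switch B e) (G.src e) < G.val B (G.src e) := by
  have h := hB.val_switch_le hG he (G.dst e)
  rw [(hB.switch hG e).val_src (mem_switch.2 (Or.inl rfl))]
  rw [hB.isImprovingSwitch_iff] at he
  linarith

/-! ### The trees returned by the algorithm -/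

/-- The tree `B` is contained in `F`, and no edge of `F` improves it. -/
structure IsOptimal (G : WeightedDigraph V E) (F B : Finset E) : Prop where
  isTree : G.IsTree B
  subset : B ⊆ F
  not_improving : ∀ e ∈ F, ¬ G.IsImprovingSwitch B e

theorem IsOptimal.val_le (h : G.IsOptimal F B) {e : E} (he : e ∈ F) :
    G.val B (G.src e) ≤ G.cost e + G.val B (G.dst e) := by
  have := h.not_improving e he
  rwa [h.isTree.isImprovingSwitch_iff, not_lt] at this

variable {σ : E → ℕ} {B' : Finset E} {k : ℕ}

open Classical in
theorem RandomFacet1P.subset (h : G.RandomFacet1P σ F B B' k) : B ⊆ F := by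
  induction h with
  | done B => exact Finset.Subset.refl B
  | stay F B B' e k he h₁ hn ih => exact ih.trans (Finset.erase_subset _ _)
  | step F B B' B'' e k₁ k₂ he h₁ hi h₂ ih₁ ih₂ => exact ih₁.trans (Finset.erase_subset _ _)

open Classical in
theorem RandomFacet1P.isOptimal (hG : G.IsRanking rk) (h : G.RandomFacet1P σ F B B' k)
    (hB : G.IsTree B) : G.IsOptimal F B' := by
  induction h with
  | done B =>
    refine ⟨hB, Finset.Subset.refl B, fun e he => ?_⟩
    rw [hB.isImprovingSwitch_iff, hB.val_src he]
    exact lt_irrefl _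
  | stay F B B' e k he h₁ hn ih =>
    refine ⟨(ih hB).isTree, (ih hB).subset.trans (Finset.erase_subset _ _), fun f hf => ?_⟩
    by_cases hfe : f = e
    · exact hfe ▸ hn
    · exact (ih hB).not_improving f (Finset.mem_erase.2 ⟨hfe, hf⟩)
  | step F B B' B'' e k₁ k₂ he h₁ hi h₂ ih₁ ih₂ => exact ih₂ ((ih₁ hB).isTree.switch hG e)

theorem RandomFacet1P.val_le (hG : G.IsRanking rk) (h : G.RandomFacet1P σ F B B' k)
    (hB : G.IsTree B) (v : V) : G.val B' v ≤ G.val B v := by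
  induction h with
  | done B => exact le_rfl
  | stay F B B' e k he h₁ hn ih => exact ih hB
  | step F B B' B'' e k₁ k₂ he h₁ hi h₂ ih₁ ih₂ =>
    have hB' := (h₁.isOptimal hG hB).isTree
    exact (ih₂ (hB'.switch hG e)).trans ((hB'.val_switch_le hG hi v).trans (ih₁ hB))

theorem exists_isFirst (hBF : B ⊆ F) (hne : F ≠ B) : ∃ e, IsFirst σ F B e := by
  classical
  have : (F \ B).Nonempty := by
    rw [Finset.sdiff_nonempty]
    exact fun h => hne (h.antisymm hBF)
  obtain ⟨e, he, hmin⟩ := Finset.exists_min_image _ σ this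
  rw [Finset.mem_sdiff] at he
  exact ⟨e, he.1, he.2, fun e' h h' => hmin e' (Finset.mem_sdiff.2 ⟨h, h'⟩)⟩

/-- The algorithm terminates on acyclic graphs. -/
theorem IsRanking.exists_randomFacet1P [Fintype V] [Finite E] (hG : G.IsRanking rk) (σ : E → ℕ)
    (hBF : B ⊆ F) (hB : G.IsTree B) : ∃ B' k, G.RandomFacet1P σ F B B' k := by
  classical
  induction hc : F.card using Nat.strong_induction_on generalizing F B with
  | _ c ihc =>
    -- The first recursive call shrinks `F`; the second keeps `F` but lowers the sum of all values.
    -- As there are finitely many edge sets, both inductions are well-founded.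
    let Φ : Finset E → ℝ := fun B => ∑ v, G.val B v
    have wf : WellFounded fun B₁ B₂ : Finset E => Φ B₁ < Φ B₂ := by
      have : IsTrans (Finset E) fun B₁ B₂ => Φ B₁ < Φ B₂ := ⟨fun _ _ _ => lt_trans⟩
      have : Std.Irrefl fun B₁ B₂ : Finset E => Φ B₁ < Φ B₂ := ⟨fun _ => lt_irrefl _⟩
      exact Finite.wellFounded_of_trans_of_irrefl _
    induction B using wf.induction with
    | _ B ih =>
      by_cases hne : F = B
      · subst hne
        exact ⟨F, 0, RandomFacet1P.done F⟩
      obtain ⟨e, he⟩ := exists_isFirst (σ := σ) hBF hne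
      have hBe : B ⊆ F.erase e := fun f hf =>
        Finset.mem_erase.2 ⟨fun h => he.2.1 (h ▸ hf), hBF hf⟩
      obtain ⟨B', k, h₁⟩ := ihc _ (hc ▸ Finset.card_erase_lt_of_mem he.1) hBe hB rfl
      by_cases hi : G.IsImprovingSwitch B' e
      · have hopt := h₁.isOptimal hG hB
        have hB' := hopt.isTree
        have hlt : Φ (G.switch B' e) < Φ B := by
          refine Finset.sum_lt_sum (fun v _ => ?_) ⟨G.src e, Finset.mem_univ _, ?_⟩
          · exact (hB'.val_switch_le hG hi v).trans (h₁.val_le hG hB v)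
          · exact (hB'.val_switch_lt hG hi).trans_le (h₁.val_le hG hB _)
        have hsub : G.switch B' e ⊆ F := by
          intro f hf
          rcases mem_switch.1 hf with rfl | ⟨hm, -⟩
          · exact he.1
          · exact Finset.erase_subset _ _ (hopt.subset hm)
        obtain ⟨B'', k', h₂⟩ := ih _ hlt hsub (hB'.switch hG e)
        exact ⟨B'', _, RandomFacet1P.step F B B' B'' e k k' he h₁ hi h₂⟩
      · exact ⟨B', k, RandomFacet1P.stay F B B' e k he h₁ hi⟩

theorem exists_randomFacet1P_numSwitches (h : ∃ B' k, G.RandomFacet1P σ F B B' k) :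
    ∃ B', G.RandomFacet1P σ F B B' (G.numSwitches σ F B) := by
  have h' : ∃ k, ∃ B', G.RandomFacet1P σ F B B' k := let ⟨B', k, h⟩ := h; ⟨k, B', h⟩
  rw [numSwitches, dif_pos h']
  exact h'.choose_spec

end WeightedDigraph

/-! ### Optimal trees of `G_{n,r,s,t}` -/

namespace LBVertex

variable {n r s : ℕ}

instance : Finite (LBVertex n r s) := by
  let f : Option (Fin n ⊕ Fin n ⊕ (Fin n × Fin r × Fin s) ⊕ (Fin n × Fin (r * s))) →
      LBVertex n r s
    | none => target
    | some (.inl i) => u i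
    | some (.inr (.inl i)) => w i
    | some (.inr (.inr (.inl x))) => a x.1 x.2.1 x.2.2
    | some (.inr (.inr (.inr x))) => b x.1 x.2
  refine Finite.of_surjective f fun v => ?_
  cases v with
  | target => exact ⟨none, rfl⟩
  | u i => exact ⟨some (.inl i), rfl⟩
  | w i => exact ⟨some (.inr (.inl i)), rfl⟩
  | a i j k => exact ⟨some (.inr (.inr (.inl (i, j, k)))), rfl⟩
  | b i j => exact ⟨some (.inr (.inr (.inr (i, j)))), rfl⟩

/-- A rank function that decreases along the edges. -/
def rank : LBVertex n r s → ℕ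
  | target => 0
  | u i => (n - 1 - i) * (r * s + s + 2) + (r * s + s + 1)
  | w i => (n - 1 - i) * (r * s + s + 2) + (r * s + s + 1)
  | a i _ k => (n - 1 - i) * (r * s + s + 2) + (r * s + (s - k))
  | b i j => (n - 1 - i) * (r * s + s + 2) + (r * s - j)

theorem rank_level_le {i : ℕ} (h : i + 1 < n) :
    (n - 1 - (i + 1)) * (r * s + s + 2) + (r * s + s + 1) ≤ (n - 1 - i) * (r * s + s + 2) := by
  have : n - 1 - i = n - 1 - (i + 1) + 1 := by omega
  rw [this, add_mul]
  omega

theorem rank_uNext_le (i : Fin n) :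
    (uNext i : LBVertex n r s).rank ≤ (n - 1 - i) * (r * s + s + 2) := by
  unfold uNext
  split_ifs with h
  · exact rank_level_le h
  · exact Nat.zero_le _

theorem rank_wNext_le (i : Fin n) :
    (wNext i : LBVertex n r s).rank ≤ (n - 1 - i) * (r * s + s + 2) := by
  unfold wNext
  split_ifs with h
  · exact rank_level_le h
  · exact Nat.zero_le _

theorem rank_bAt_le (i : Fin n) (m : ℕ) :
    (bAt i m : LBVertex n r s).rank ≤ (n - 1 - i) * (r * s + s + 2) + (r * s - m) := by
  unfold bAt
  split_ifs with h
  · exact le_rfl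
  · exact (rank_wNext_le i).trans (Nat.le_add_right _ _)

theorem rank_aAt_le (i : Fin n) (j : Fin r) (m : ℕ) :
    (aAt i j m : LBVertex n r s).rank ≤ (n - 1 - i) * (r * s + s + 2) + (r * s + (s - m)) := by
  unfold aAt
  split_ifs with h
  · exact le_rfl
  · refine (rank_bAt_le i 0).trans ?_
    omega

/-- The vertex `u_i`, which is the target if `i` is past the last level. -/
def uAt (i : ℕ) : LBVertex n r s := if h : i < n then u ⟨i, h⟩ else target

/-- The vertex `w_i`, which is the target if `i` is past the last level. -/
def wAt (i : ℕ) : LBVertex n r s := if h : i < n then w ⟨i, h⟩ else target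

theorem uAt_coe (i : Fin n) : (uAt (i : ℕ) : LBVertex n r s) = u i := by simp [uAt]

theorem wAt_coe (i : Fin n) : (wAt (i : ℕ) : LBVertex n r s) = w i := by simp [wAt]

theorem bAt_coe (i : Fin n) (j : Fin (r * s)) : (bAt i (j : ℕ) : LBVertex n r s) = b i j := by
  simp [bAt]

theorem aAt_coe (i : Fin n) (j : Fin r) (k : Fin s) :
    (aAt i j (k : ℕ) : LBVertex n r s) = a i j k := by
  simp [aAt]

theorem bAt_length (i : Fin n) : (bAt i (r * s) : LBVertex n r s) = wNext i := by simp [bAt]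

theorem aAt_length (i : Fin n) (j : Fin r) : (aAt i j s : LBVertex n r s) = bAt i 0 := by
  simp [aAt]

end LBVertex

section LowerBound

open LBVertex LBEdge

variable {n r s t : ℕ}

theorem lbGraph_isRanking : (lbGraph n r s t).IsRanking LBVertex.rank where
  lt e := by
    cases e with
    | a1 i j k =>
      refine (rank_aAt_le i j (k + 1)).trans_lt ?_
      show _ < (n - 1 - (i : ℕ)) * (r * s + s + 2) + (r * s + (s - k))
      omega
    | a0 i j k l =>
      refine (rank_uNext_le i).trans_lt ?_
      show _ < (n - 1 - (i : ℕ)) * (r * s + s + 2) + (r * s + (s - k))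
      omega
    | b1 i j =>
      refine (rank_bAt_le i (j + 1)).trans_lt ?_
      show _ < (n - 1 - (i : ℕ)) * (r * s + s + 2) + (r * s - j)
      omega
    | b0 i j l =>
      refine (rank_uNext_le i).trans_lt ?_
      show _ < (n - 1 - (i : ℕ)) * (r * s + s + 2) + (r * s - j)
      omega
    | u1 i l =>
      refine (rank_bAt_le i 0).trans_lt ?_
      show _ < (n - 1 - (i : ℕ)) * (r * s + s + 2) + (r * s + s + 1)
      omega
    | u0 i l =>
      refine (rank_uNext_le i).trans_lt ?_
      show _ < (n - 1 - (i : ℕ)) * (r * s + s + 2) + (r * s + s + 1)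
      omega
    | w1 i j l =>
      refine (rank_aAt_le i j 0).trans_lt ?_
      show _ < (n - 1 - (i : ℕ)) * (r * s + s + 2) + (r * s + s + 1)
      omega
    | w0 i l =>
      refine (rank_wNext_le i).trans_lt ?_
      show _ < (n - 1 - (i : ℕ)) * (r * s + s + 2) + (r * s + s + 1)
      omega
  src_ne e := by cases e <;> simp [lbGraph, LBEdge.src]

/-- The cost `2^{2i}` of the edges that skip a level. -/
noncomputable def levelCost (i : ℕ) : ℝ := 2 ^ (2 * (i + 1))

theorem levelCost_succ (i : ℕ) : levelCost (i + 1) = 4 * levelCost i := by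
  unfold levelCost
  rw [show 2 * (i + 1 + 1) = 2 * (i + 1) + 2 by ring, pow_add]
  ring

theorem four_le_levelCost (i : ℕ) : 4 ≤ levelCost i := by
  unfold levelCost
  calc (4 : ℝ) = 2 ^ 2 := by norm_num
    _ ≤ 2 ^ (2 * (i + 1)) := pow_le_pow_right₀ (by norm_num) (by omega)

theorem two_pow_eq (i : ℕ) : (2 : ℝ) ^ (2 * (i + 1) + 1) = 2 * levelCost i := by
  unfold levelCost
  ring

namespace LBGraph

/-- The value `y_T(v)` in `G_{n,r,s,t}`. -/
noncomputable abbrev y (T : Finset (LBEdge n r s t)) (v : LBVertex n r s) : ℝ :=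
  (lbGraph n r s t).val T v

/-! ### Value bounds in an arbitrary tree. -/

section Tree

variable {T : Finset (LBEdge n r s t)}

theorem y_uAt_last (hT : (lbGraph n r s t).IsTree T) : y T (uAt n) = 0 := by
  rw [uAt, dif_neg (lt_irrefl n)]
  exact hT.val_target

theorem y_wAt_last (hT : (lbGraph n r s t).IsTree T) : y T (wAt n) = 0 := by
  rw [wAt, dif_neg (lt_irrefl n)]
  exact hT.val_target

theorem y_u (hT : (lbGraph n r s t).IsTree T)
    (i : Fin n) :
    y T (uAt i) = y T (bAt i 0) ∨ y T (uAt i) = levelCost i + y T (uAt (i + 1)) := by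
  rw [uAt_coe]
  obtain ⟨e, ⟨he, hs⟩, -⟩ := hT.1 (.u i) (by simp [lbGraph])
  have h := hT.val_src he
  cases e <;> simp only [lbGraph, LBEdge.src, reduceCtorEq, LBVertex.u.injEq] at hs <;> subst hs
  · exact Or.inl (h.trans (zero_add _))
  · exact Or.inr h

theorem y_w (hT : (lbGraph n r s t).IsTree T)
    (i : Fin n) :
    (∃ j, y T (wAt i) = y T (aAt i j 0)) ∨ y T (wAt i) = levelCost i + y T (wAt (i + 1)) := by
  rw [wAt_coe]
  obtain ⟨e, ⟨he, hs⟩, -⟩ := hT.1 (.w i) (by simp [lbGraph])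
  have h := hT.val_src he
  cases e <;> simp only [lbGraph, LBEdge.src, reduceCtorEq, LBVertex.w.injEq] at hs <;> subst hs
  · exact Or.inl ⟨_, h.trans (zero_add _)⟩
  · exact Or.inr h

theorem y_b (hT : (lbGraph n r s t).IsTree T)
    (i : Fin n) (j : Fin (r * s)) :
    (b1 i j ∈ T ∧ y T (bAt i j) = y T (bAt i (j + 1))) ∨
      (b1 i j ∉ T ∧ y T (bAt i j) =
        2 * levelCost i + 1 + (j : ℕ) * (1 / ((r : ℝ) * s)) + y T (uAt (i + 1))) := by
  rw [bAt_coe]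
  obtain ⟨e, ⟨he, hs⟩, hu⟩ := hT.1 (.b i j) (by simp [lbGraph])
  have h := hT.val_src he
  cases e <;> simp only [lbGraph, LBEdge.src, reduceCtorEq, LBVertex.b.injEq] at hs <;>
    obtain ⟨rfl, rfl⟩ := hs
  · exact Or.inl ⟨he, h.trans (zero_add _)⟩
  · refine Or.inr ⟨fun h' => ?_, ?_⟩
    · cases hu _ ⟨h', rfl⟩
    · rw [← two_pow_eq]
      exact h

theorem y_a (hT : (lbGraph n r s t).IsTree T)
    (i : Fin n) (j : Fin r) (k : Fin s) :
    (a1 i j k ∈ T ∧ y T (aAt i j k) = y T (aAt i j (k + 1))) ∨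
      (a1 i j k ∉ T ∧ y T (aAt i j k) =
        2 * levelCost i + (k : ℕ) * (1 / ((r : ℝ) * s)) + y T (uAt (i + 1))) := by
  rw [aAt_coe]
  obtain ⟨e, ⟨he, hs⟩, hu⟩ := hT.1 (.a i j k) (by simp [lbGraph])
  have h := hT.val_src he
  cases e <;> simp only [lbGraph, LBEdge.src, reduceCtorEq, LBVertex.a.injEq] at hs <;>
    obtain ⟨rfl, rfl, rfl⟩ := hs
  · exact Or.inl ⟨he, h.trans (zero_add _)⟩
  · refine Or.inr ⟨fun h' => ?_, ?_⟩
    · cases hu _ ⟨h', rfl⟩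
    · rw [← two_pow_eq]
      exact h

/-- The exit prices increase along the path by `ε` per step. A vertex before position `J` either
exits at its own price or moves on to a vertex that costs at least the next, higher price. -/
theorem le_y_bAt (hT : (lbGraph n r s t).IsTree T)
    (i : Fin n) {J : ℕ} (hJ : J ≤ r * s)
    (h : 2 * levelCost i + 1 + J * (1 / ((r : ℝ) * s)) + y T (uAt (i + 1)) ≤ y T (bAt i J))
    {m : ℕ} (hm : m ≤ J) :
    2 * levelCost i + 1 + m * (1 / ((r : ℝ) * s)) + y T (uAt (i + 1)) ≤ y T (bAt i m) := by
  induction hm using Nat.decreasingInduction with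
  | self => exact h
  | of_succ m hm ih =>
    have hε : 0 ≤ 1 / ((r : ℝ) * s) := by positivity
    rcases y_b hT i ⟨m, by omega⟩ with ⟨-, h'⟩ | ⟨-, h'⟩
    · simp only at h'
      rw [h']
      push_cast at ih
      linarith
    · simp only at h'
      rw [h']

theorem le_y_aAt (hT : (lbGraph n r s t).IsTree T)
    (i : Fin n) (j : Fin r) {J : ℕ} (hJ : J ≤ s)
    (h : 2 * levelCost i + J * (1 / ((r : ℝ) * s)) + y T (uAt (i + 1)) ≤ y T (aAt i j J))
    {m : ℕ} (hm : m ≤ J) :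
    2 * levelCost i + m * (1 / ((r : ℝ) * s)) + y T (uAt (i + 1)) ≤ y T (aAt i j m) := by
  induction hm using Nat.decreasingInduction with
  | self => exact h
  | of_succ m hm ih =>
    have hε : 0 ≤ 1 / ((r : ℝ) * s) := by positivity
    rcases y_a hT i j ⟨m, by omega⟩ with ⟨-, h'⟩ | ⟨-, h'⟩
    · simp only at h'
      rw [h']
      push_cast at ih
      linarith
    · simp only at h'
      rw [h']

theorem le_y_bAt_zero_of_not_mem (hT : (lbGraph n r s t).IsTree T)
    (i : Fin n) {j : Fin (r * s)} (hj : b1 i j ∉ T) :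
    2 * levelCost i + 1 + y T (uAt (i + 1)) ≤ y T (bAt i 0) := by
  have h := le_y_bAt hT i j.2.le (m := 0) ?_ (Nat.zero_le _)
  · simpa using h
  · rcases y_b hT i j with ⟨h, -⟩ | ⟨-, h⟩
    · exact absurd h hj
    · exact h.ge

theorem le_y_aAt_zero_of_not_mem (hT : (lbGraph n r s t).IsTree T)
    (i : Fin n) {j : Fin r} {k : Fin s} (hk : a1 i j k ∉ T) :
    2 * levelCost i + y T (uAt (i + 1)) ≤ y T (aAt i j 0) := by
  have h := le_y_aAt hT i j k.2.le (m := 0) ?_ (Nat.zero_le _)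
  · simpa using h
  · rcases y_a hT i j k with ⟨h, -⟩ | ⟨-, h⟩
    · exact absurd h hk
    · exact h.ge

/-- Since `s ε ≤ 1`, the extra 1 in the price of `b_{i,1}` covers the exit price at a fictitious
position `s`, so the bound propagates backwards from the end of the `a`-path. -/
theorem le_y_aAt_of_le_y_bAt (hT : (lbGraph n r s t).IsTree T)
    (hr : 0 < r) (hs : 0 < s) (i : Fin n)
    (h : 2 * levelCost i + 1 + y T (uAt (i + 1)) ≤ y T (bAt i 0)) (j : Fin r) {m : ℕ}
    (hm : m ≤ s) :
    2 * levelCost i + m * (1 / ((r : ℝ) * s)) + y T (uAt (i + 1)) ≤ y T (aAt i j m) := by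
  refine le_y_aAt hT i j le_rfl ?_ hm
  rw [aAt_length]
  have hr' : (1 : ℝ) ≤ r := by exact_mod_cast hr
  have hs' : (0 : ℝ) < s := by exact_mod_cast hs
  have : (s : ℝ) * (1 / ((r : ℝ) * s)) ≤ 1 := by
    rw [mul_one_div, div_le_one (by positivity)]
    nlinarith
  linarith

theorem le_y_bAt_of_le (hT : (lbGraph n r s t).IsTree T)
    (i : Fin n) {V : ℝ} (hu : V ≤ y T (uAt (i + 1)))
    (hw : V ≤ y T (wAt (i + 1))) {m : ℕ} (hm : m ≤ r * s) : V ≤ y T (bAt i m) := by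
  induction hm using Nat.decreasingInduction with
  | self => rw [bAt_length]; exact hw
  | of_succ m hm ih =>
    have hε : 0 ≤ (m : ℝ) * (1 / ((r : ℝ) * s)) := by positivity
    have := four_le_levelCost i
    rcases y_b hT i ⟨m, by omega⟩ with ⟨-, h'⟩ | ⟨-, h'⟩ <;> simp only at h' <;> rw [h']
    · exact ih
    · linarith

theorem le_y_aAt_of_le (hT : (lbGraph n r s t).IsTree T)
    (i : Fin n) (j : Fin r) {V : ℝ} (hu : V ≤ y T (uAt (i + 1)))
    (hb : V ≤ y T (bAt i 0)) {m : ℕ} (hm : m ≤ s) : V ≤ y T (aAt i j m) := by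
  induction hm using Nat.decreasingInduction with
  | self => rw [aAt_length]; exact hb
  | of_succ m hm ih =>
    have hε : 0 ≤ (m : ℝ) * (1 / ((r : ℝ) * s)) := by positivity
    have := four_le_levelCost i
    rcases y_a hT i j ⟨m, by omega⟩ with ⟨-, h'⟩ | ⟨-, h'⟩ <;> simp only at h' <;> rw [h']
    · exact ih
    · linarith

end Tree

/-- Every group of parallel edges has a copy in `F`. -/
structure Available (F : Finset (LBEdge n r s t)) : Prop where
  a0 : ∀ i j k, ∃ l, a0 i j k l ∈ F
  b0 : ∀ i j, ∃ l, b0 i j l ∈ F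
  u1 : ∀ i, ∃ l, u1 i l ∈ F
  u0 : ∀ i, ∃ l, u0 i l ∈ F
  w1 : ∀ i j, ∃ l, w1 i j l ∈ F
  w0 : ∀ i, ∃ l, w0 i l ∈ F

theorem Available.mono {F F' : Finset (LBEdge n r s t)} (h : Available F) (hF : F ⊆ F') :
    Available F' where
  a0 i j k := (h.a0 i j k).imp fun _ h => hF h
  b0 i j := (h.b0 i j).imp fun _ h => hF h
  u1 i := (h.u1 i).imp fun _ h => hF h
  u0 i := (h.u0 i).imp fun _ h => hF h
  w1 i j := (h.w1 i j).imp fun _ h => hF h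
  w0 i := (h.w0 i).imp fun _ h => hF h

/-- The `b`-path of level `i` is contained in `F`. -/
def BChain (F : Finset (LBEdge n r s t)) (i : Fin n) : Prop := ∀ j, b1 i j ∈ F

/-- The `j`-th `a`-path of level `i` is contained in `F`. -/
def AChain (F : Finset (LBEdge n r s t)) (i : Fin n) (j : Fin r) : Prop := ∀ k, a1 i j k ∈ F

/-! ### Values and complete paths in a tree that is optimal for its edge set. -/

section Optimal

variable {F T : Finset (LBEdge n r s t)}

theorem y_bAt_le_of_mem (hT : (lbGraph n r s t).IsOptimal F T)
    {i : Fin n} {j : Fin (r * s)} (h : b1 i j ∈ F) :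
    y T (bAt i j) ≤ y T (bAt i (j + 1)) := by
  rw [bAt_coe]
  exact (hT.val_le h).trans (zero_add _).le

theorem y_aAt_le_of_mem (hT : (lbGraph n r s t).IsOptimal F T)
    {i : Fin n} {j : Fin r} {k : Fin s} (h : a1 i j k ∈ F) :
    y T (aAt i j k) ≤ y T (aAt i j (k + 1)) := by
  rw [aAt_coe]
  exact (hT.val_le h).trans (zero_add _).le

theorem y_bAt_le_of_bChain (hT : (lbGraph n r s t).IsOptimal F T)
    {i : Fin n} (h : BChain F i) {m : ℕ} (hm : m ≤ r * s) :
    y T (bAt i m) ≤ y T (wAt (i + 1)) := by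
  induction hm using Nat.decreasingInduction with
  | self => rw [bAt_length]; exact le_rfl
  | of_succ m hm ih => exact (y_bAt_le_of_mem hT (h ⟨m, hm⟩)).trans ih

theorem y_aAt_le_of_aChain (hT : (lbGraph n r s t).IsOptimal F T)
    {i : Fin n} {j : Fin r} (h : AChain F i j) {m : ℕ} (hm : m ≤ s) :
    y T (aAt i j m) ≤ y T (bAt i 0) := by
  induction hm using Nat.decreasingInduction with
  | self => rw [aAt_length]
  | of_succ m hm ih => exact (y_aAt_le_of_mem hT (h ⟨m, hm⟩)).trans ih

/-- Following the complete path costs at most `w_{i+1}`, which equals `u_{i+1}`, whereas each exit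
pays more than that; so the tree never exits. -/
theorem bChain_tree (hT : (lbGraph n r s t).IsOptimal F T)
    {i : Fin n} (h : BChain F i) (hi : y T (uAt (i + 1)) = y T (wAt (i + 1))) :
    BChain T i := by
  intro j
  rcases y_b hT.isTree i j with ⟨h', -⟩ | ⟨-, h'⟩
  · exact h'
  · have h₁ := y_bAt_le_of_bChain hT h j.2.le
    have hε : 0 ≤ (j : ℝ) * (1 / ((r : ℝ) * s)) := by positivity
    have := four_le_levelCost i
    linarith

theorem aChain_tree (hT : (lbGraph n r s t).IsOptimal F T)
    {i : Fin n} {j : Fin r} (hj : AChain F i j) (h : BChain F i)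
    (hi : y T (uAt (i + 1)) = y T (wAt (i + 1))) : AChain T i j := by
  intro k
  rcases y_a hT.isTree i j k with ⟨h', -⟩ | ⟨-, h'⟩
  · exact h'
  · have h₁ := y_aAt_le_of_aChain hT hj k.2.le
    have h₂ := y_bAt_le_of_bChain hT h (Nat.zero_le _)
    have hε : 0 ≤ (k : ℝ) * (1 / ((r : ℝ) * s)) := by positivity
    have := four_le_levelCost i
    linarith

theorem y_u_le_zero (hT : (lbGraph n r s t).IsOptimal F T) (hF : Available F)
    (i : Fin n) : y T (uAt i) ≤ levelCost i + y T (uAt (i + 1)) := by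
  obtain ⟨l, hl⟩ := hF.u0 i
  rw [uAt_coe]
  exact hT.val_le hl

theorem y_u_le_one (hT : (lbGraph n r s t).IsOptimal F T) (hF : Available F)
    (i : Fin n) : y T (uAt i) ≤ y T (bAt i 0) := by
  obtain ⟨l, hl⟩ := hF.u1 i
  rw [uAt_coe]
  exact (hT.val_le hl).trans (zero_add _).le

theorem y_w_le_zero (hT : (lbGraph n r s t).IsOptimal F T) (hF : Available F)
    (i : Fin n) : y T (wAt i) ≤ levelCost i + y T (wAt (i + 1)) := by
  obtain ⟨l, hl⟩ := hF.w0 i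
  rw [wAt_coe]
  exact hT.val_le hl

theorem y_w_le_one (hT : (lbGraph n r s t).IsOptimal F T) (hF : Available F)
    (i : Fin n) (j : Fin r) : y T (wAt i) ≤ y T (aAt i j 0) := by
  obtain ⟨l, hl⟩ := hF.w1 i j
  rw [wAt_coe]
  exact (hT.val_le hl).trans (zero_add _).le

theorem y_b_le_zero (hT : (lbGraph n r s t).IsOptimal F T) (hF : Available F)
    (i : Fin n) (j : Fin (r * s)) : y T (bAt i j) ≤
    2 * levelCost i + 1 + (j : ℕ) * (1 / ((r : ℝ) * s)) + y T (uAt (i + 1)) := by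
  obtain ⟨l, hl⟩ := hF.b0 i j
  rw [bAt_coe, ← two_pow_eq]
  exact hT.val_le hl

theorem y_a_le_zero (hT : (lbGraph n r s t).IsOptimal F T) (hF : Available F)
    (i : Fin n) (j : Fin r) (k : Fin s) : y T (aAt i j k) ≤
    2 * levelCost i + (k : ℕ) * (1 / ((r : ℝ) * s)) + y T (uAt (i + 1)) := by
  obtain ⟨l, hl⟩ := hF.a0 i j k
  rw [aAt_coe, ← two_pow_eq]
  exact hT.val_le hl

/-- When `b_{i,1}` is expensive, moving one step along an `a`-path costs at least the exit price of
the next position, which is strictly larger by `ε > 0`. This strictness is what forces the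
zero-edges. -/
theorem a1_not_mem_of_le (hT : (lbGraph n r s t).IsOptimal F T) (hF : Available F)
    (hr : 0 < r) (hs : 0 < s) {i : Fin n}
    (h : 2 * levelCost i + 1 + y T (uAt (i + 1)) ≤ y T (bAt i 0)) (j : Fin r) (k : Fin s) :
    a1 i j k ∉ T := by
  intro hk
  rcases y_a hT.isTree i j k with ⟨-, h'⟩ | ⟨h', -⟩
  · have h₁ := le_y_aAt_of_le_y_bAt hT.isTree hr hs i h j (m := k + 1) k.2
    have h₂ := y_a_le_zero hT hF i j k
    have hr' : (0 : ℝ) < r := by exact_mod_cast hr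
    have hs' : (0 : ℝ) < s := by exact_mod_cast hs
    have hε : 0 < 1 / ((r : ℝ) * s) := by positivity
    push_cast at h₁
    linarith
  · exact h' hk

theorem a1_not_mem_of_not_bChain (hT : (lbGraph n r s t).IsOptimal F T) (hF : Available F)
    (hr : 0 < r) (hs : 0 < s) {i : Fin n} (h : ¬ BChain F i)
    (j : Fin r) (k : Fin s) : a1 i j k ∉ T := by
  obtain ⟨j', hj'⟩ := not_forall.1 h
  exact a1_not_mem_of_le hT hF hr hs
    (le_y_bAt_zero_of_not_mem hT.isTree i fun h => hj' (hT.subset h)) j k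

/-- The values of `u_i` and `w_i` agree if they agree for the next level and the paths of level `i`
are consistent. -/
theorem y_u_eq_y_w_of_next (hT : (lbGraph n r s t).IsOptimal F T) (hF : Available F)
    (hr : 0 < r) (hs : 0 < s) (i : Fin n)
    (hi : y T (uAt (i + 1)) = y T (wAt (i + 1)))
    (h : BChain F i → ∃ j, AChain F i j) : y T (uAt i) = y T (wAt i) := by
  have h4 := four_le_levelCost i
  by_cases hb : BChain F i
  -- Bit set: both vertices reach the next level for free, and nothing is cheaper.
  · obtain ⟨j, hj⟩ := h hb
    have hb₀ : y T (bAt i 0) = y T (uAt (i + 1)) :=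
      le_antisymm ((y_bAt_le_of_bChain hT hb (Nat.zero_le _)).trans hi.ge)
        (le_y_bAt_of_le hT.isTree i le_rfl hi.le (Nat.zero_le _))
    have hu : y T (uAt i) = y T (uAt (i + 1)) := by
      have h₁ := y_u_le_one hT hF i
      rcases y_u hT.isTree i with h₂ | h₂ <;> linarith
    have hw : y T (wAt i) = y T (uAt (i + 1)) := by
      have h₁ := y_w_le_one hT hF i j
      have h₂ := y_aAt_le_of_aChain hT hj (Nat.zero_le _)
      rcases y_w hT.isTree i with ⟨j', h₃⟩ | h₃
      · have := le_y_aAt_of_le hT.isTree i j' le_rfl hb₀.ge (Nat.zero_le _)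
        linarith
      · linarith
    rw [hu, hw]
  -- Bit unset: a detour through either path costs at least `2 * levelCost i`, so both vertices skip
  -- the level.
  · obtain ⟨j, hj⟩ := not_forall.1 hb
    have hb₀ := le_y_bAt_zero_of_not_mem hT.isTree i fun h => hj (hT.subset h)
    have hu : y T (uAt i) = levelCost i + y T (uAt (i + 1)) := by
      have h₁ := y_u_le_zero hT hF i
      rcases y_u hT.isTree i with h₂ | h₂ <;> linarith
    have hw : y T (wAt i) = levelCost i + y T (uAt (i + 1)) := by
      have h₁ := y_w_le_zero hT hF i
      rcases y_w hT.isTree i with ⟨j', h₃⟩ | h₃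
      · have := le_y_aAt_of_le_y_bAt hT.isTree hr hs i hb₀ j' (Nat.zero_le _)
        push_cast at this
        linarith
      · linarith
    rw [hu, hw]

theorem y_u_eq_y_w (hT : (lbGraph n r s t).IsOptimal F T) (hF : Available F)
    (hr : 0 < r) (hs : 0 < s) {m : ℕ} (hm : m ≤ n)
    (h : ∀ i : Fin n, m ≤ i → BChain F i → ∃ j, AChain F i j) : y T (uAt m) = y T (wAt m) := by
  induction hm using Nat.decreasingInduction with
  | self => rw [y_uAt_last hT.isTree, y_wAt_last hT.isTree]
  | of_succ m hm ih =>
    exact y_u_eq_y_w_of_next hT hF hr hs ⟨m, hm⟩ (ih fun i hi => h i (by omega)) (h ⟨m, hm⟩ le_rfl)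

/-- If the `b`-path of level `l` is complete but none of its `a`-paths is, then `w` is much more
expensive than `u` on the lower levels. -/
theorem levelCost_le_gap (hT : (lbGraph n r s t).IsOptimal F T) (hF : Available F)
    (hr : 0 < r) (hs : 0 < s) {l : Fin n}
    (hl : y T (uAt (l + 1)) = y T (wAt (l + 1))) (hb : BChain F l)
    (ha : ∀ j, ¬ AChain F l j) {m : ℕ} (hm : m ≤ l) :
    levelCost m + y T (uAt m) ≤ y T (wAt m) := by
  have hrs : 0 < r * s := Nat.mul_pos hr hs
  induction hm using Nat.decreasingInduction with
  | self =>
    have h4 := four_le_levelCost l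
    have h₁ := y_u_le_one hT hF l
    have h₂ := y_bAt_le_of_bChain hT hb (Nat.zero_le _)
    rcases y_w hT.isTree l with ⟨j, h₃⟩ | h₃
    · obtain ⟨k, hk⟩ := not_forall.1 (ha j)
      have := le_y_aAt_zero_of_not_mem hT.isTree l (j := j) (k := k) fun h => hk (hT.subset h)
      linarith
    · linarith
  | of_succ m hm ih =>
    have h4 := four_le_levelCost m
    -- The gap at `m + 1` is four times `levelCost m`: enough to make the path through `w_{m+1}`
    -- worse than any exit, and to leave a gap of `levelCost m` at level `m`.
    rw [levelCost_succ] at ih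
    have h₁ := y_u_le_zero hT hF ⟨m, by omega⟩
    have hb₀ := le_y_bAt hT.isTree ⟨m, by omega⟩ le_rfl (m := 0) ?_ (Nat.zero_le _)
    · rcases y_w hT.isTree ⟨m, by omega⟩ with ⟨j, h₃⟩ | h₃
      · have := le_y_aAt_of_le_y_bAt hT.isTree hr hs ⟨m, by omega⟩ (by simpa using hb₀) j
          (Nat.zero_le _)
        simp only [Nat.cast_zero, zero_mul, add_zero] at this h₃ h₁ ⊢
        linarith
      · simp only at h₃ h₁
        linarith
    · rw [bAt_length]
      have hr' : (0 : ℝ) < r := by exact_mod_cast hr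
      have hs' : (0 : ℝ) < s := by exact_mod_cast hs
      have : ((r * s : ℕ) : ℝ) * (1 / ((r : ℝ) * s)) = 1 := by
        push_cast
        field_simp
      rw [this]
      change _ ≤ y T (wAt (m + 1))
      simp only
      linarith

/-- The lower levels are reset. -/
theorem b1_not_mem_of_reset (hT : (lbGraph n r s t).IsOptimal F T) (hF : Available F)
    (hr : 0 < r) (hs : 0 < s) {l : Fin n}
    (hl : y T (uAt (l + 1)) = y T (wAt (l + 1))) (hb : BChain F l)
    (ha : ∀ j, ¬ AChain F l j) {i : Fin n} (hi : i < l)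
    (j : Fin (r * s)) : b1 i j ∉ T := by
  have hgap := levelCost_le_gap hT hF hr hs hl hb ha (m := i + 1) hi
  rw [levelCost_succ] at hgap
  have h4 := four_le_levelCost i
  have hr' : (0 : ℝ) < r := by exact_mod_cast hr
  have hs' : (0 : ℝ) < s := by exact_mod_cast hs
  -- The end of the `b`-path costs at least `4 * levelCost i` more than `u_{i+1}`. This exceeds the
  -- fictitious exit price at position `r s`, where the surcharge `r s ε` is exactly 1.
  have hlow : ∀ m ≤ r * s,
      2 * levelCost i + 1 + m * (1 / ((r : ℝ) * s)) + y T (uAt (i + 1)) ≤ y T (bAt i m) := by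
    intro m hm
    refine le_y_bAt hT.isTree i le_rfl ?_ hm
    have : ((r * s : ℕ) : ℝ) * (1 / ((r : ℝ) * s)) = 1 := by
      push_cast
      field_simp
    rw [bAt_length, this]
    change _ ≤ y T (wAt (i + 1))
    linarith
  intro hj
  rcases y_b hT.isTree i j with ⟨-, h'⟩ | ⟨h', -⟩
  · have h₁ := hlow (j + 1) j.2
    have h₂ := y_b_le_zero hT hF i j
    have hε : 0 < 1 / ((r : ℝ) * s) := by positivity
    push_cast at h₁
    linarith
  · exact h' hj

end Optimal

end LBGraph

/-! ### Counting -/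

namespace LBGraph

/-- The subsets of `N` on which `β` is strictly decreasing. -/
def antitoneSets (β : Fin n → ℕ) (N : Finset (Fin n)) : Finset (Finset (Fin n)) :=
  N.powerset.filter fun S => ∀ i ∈ S, ∀ j ∈ S, i < j → β j < β i

theorem card_antitoneSets_empty (β : Fin n → ℕ) : (antitoneSets β ∅).card = 1 := by
  simp [antitoneSets, Finset.filter_singleton]

/-- The recursion behind the counter: split according to whether the level `l` that is completed
last belongs to the set. -/
theorem card_antitoneSets_le (β : Fin n → ℕ) {N : Finset (Fin n)} {l : Fin n}
    (hmin : ∀ i ∈ N, β l ≤ β i) :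
    (antitoneSets β N).card ≤
      (antitoneSets β (N.erase l)).card + (antitoneSets β (N.filter (· < l))).card := by
  have h : antitoneSets β N ⊆ antitoneSets β (N.erase l) ∪
      (antitoneSets β (N.filter (· < l))).image (insert l) := by
    intro S hS
    simp only [antitoneSets, Finset.mem_filter, Finset.mem_powerset] at hS
    simp only [antitoneSets, Finset.mem_union, Finset.mem_image, Finset.mem_filter,
      Finset.mem_powerset]
    -- As `β l` is minimal, a member of `S` above `l` would violate the decrease; so `l` is the
    -- largest element of `S` if it belongs to `S`.
    by_cases hl : l ∈ S
    · refine Or.inr ⟨S.erase l, ⟨fun i hi => ?_, fun i hi j hj => ?_⟩, Finset.insert_erase hl⟩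
      · rw [Finset.mem_erase] at hi
        refine Finset.mem_filter.2 ⟨hS.1 hi.2, ?_⟩
        by_contra hil
        exact (hS.2 l hl i hi.2 (lt_of_le_of_ne (not_lt.1 hil) hi.1.symm)).not_ge
          (hmin i (hS.1 hi.2))
      · exact hS.2 i (Finset.mem_of_mem_erase hi) j (Finset.mem_of_mem_erase hj)
    · exact Or.inl ⟨fun i hi => Finset.mem_erase.2 ⟨fun h => hl (h ▸ hi), hS.1 hi⟩, hS.2⟩
  exact (Finset.card_le_card h).trans ((Finset.card_union_le _ _).trans
    (Nat.add_le_add_left Finset.card_image_le _))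

/-- The index at which the `b`-path of level `i` is completed. -/
noncomputable def completion (σ : LBEdge n r s t → ℕ) (i : Fin n) : ℕ :=
  sInf (Set.range fun j => σ (b1 i j))

theorem completion_le (σ : LBEdge n r s t → ℕ) (i : Fin n) (j : Fin (r * s)) :
    completion σ i ≤ σ (b1 i j) := Nat.sInf_le ⟨j, rfl⟩

theorem exists_completion_eq (hr : 0 < r) (hs : 0 < s) (σ : LBEdge n r s t → ℕ) (i : Fin n) :
    ∃ j, σ (b1 i j) = completion σ i :=
  Nat.sInf_mem (s := Set.range fun j => σ (b1 i j)) ⟨_, ⟨⟨0, Nat.mul_pos hr hs⟩, rfl⟩⟩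

/-- The permutations for which all levels work as bits of the counter: every group of parallel
edges has a copy with index at least `h`, every `a`-path has an edge with index less than `h`, every
`b`-path has an edge with index less than `z`, and on every level there is an `a`-path whose indices
are all at least `z`. -/
structure WellOrdered (σ : LBEdge n r s t → ℕ) (z h : ℕ) : Prop where
  available : Available (Finset.univ.filter fun e => h ≤ σ e)
  a_lt : ∀ i j, ∃ k, σ (a1 i j k) < h
  b_lt : ∀ i, ∃ j, σ (b1 i j) < z
  le_a : ∀ i, ∃ j, ∀ k, z ≤ σ (a1 i j k)

/-- The invariant under which a call counts with the levels below `i`. -/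
structure Ready (σ : LBEdge n r s t → ℕ) (z h : ℕ) (F B : Finset (LBEdge n r s t)) (i : ℕ) :
    Prop where
  high : ∀ e, h ≤ σ e → e ∈ F
  b1_not_mem : ∀ i' : Fin n, (i' : ℕ) < i → ∀ j, b1 i' j ∉ B
  aChain : ∀ i', BChain F i' → ∃ j, ∀ k, a1 i' j k ∈ F ∧ z ≤ σ (a1 i' j k)
  bChain : ∀ i' : Fin n, i ≤ i' → BChain F i' → BChain B i'

/-- The invariant under which a call completes the level `l`, on which no edge `a1` is used. -/
structure Pending (σ : LBEdge n r s t → ℕ) (z h : ℕ) (F B : Finset (LBEdge n r s t)) (l : Fin n) :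
    Prop where
  high : ∀ e, h ≤ σ e → e ∈ F
  bChain_self : BChain F l
  aChain_self : ∃ j, ∀ k, a1 l j k ∈ F ∧ z ≤ σ (a1 l j k)
  a1_not_mem : ∀ j k, a1 l j k ∉ B
  chains : ∀ i, i ≠ l → BChain F i → BChain B i ∧ ∃ j, ∀ k, a1 i j k ∈ B ∧ z ≤ σ (a1 i j k)

/-! ### Following the counter through the recursive calls. -/

section

variable {σ : LBEdge n r s t → ℕ} {z h : ℕ} {F B B' : Finset (LBEdge n r s t)} {k : ℕ}

theorem available_of_high (hσ : WellOrdered σ z h) (hF : ∀ e, h ≤ σ e → e ∈ F) : Available F :=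
  hσ.available.mono fun e he => hF e (Finset.mem_filter.1 he).2

theorem BChain.mono {i : Fin n} (h : BChain B i) (hBF : B ⊆ F) : BChain F i := fun j => hBF (h j)

/-- Edges of level `l` that are switched do not affect the chains of other levels. -/
theorem mem_switch_of_mem {e f : LBEdge n r s t} (hf : f ∈ B) (hne : f.src ≠ e.src) :
    f ∈ (lbGraph n r s t).switch B e :=
  WeightedDigraph.mem_switch.2 (Or.inr ⟨hf, hne⟩)

theorem mem_of_mem_switch {e f : LBEdge n r s t} (hf : f ∈ (lbGraph n r s t).switch B e)
    (hne : f ≠ e) : f ∈ B :=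
  (WeightedDigraph.mem_switch.1 hf).elim (fun h => absurd h hne) fun h => h.1

/-- After the last missing edge `b1 l j` has been switched, level `l` is pending. -/
theorem pending_switch (hr : 0 < r) (hs : 0 < s) (hσ : WellOrdered σ z h) {l : Fin n}
    {j : Fin (r * s)} {F' T : Finset (LBEdge n r s t)}
    (hF' : ∀ f, f ∈ F' ↔ f ≠ b1 l j ∧ f ∈ F) (hhigh : ∀ e, h ≤ σ e → e ∈ F)
    (hhigh' : σ (b1 l j) < h) (hb : BChain F l)
    (ha : ∀ i, BChain F i → ∃ j, ∀ k, a1 i j k ∈ F ∧ z ≤ σ (a1 i j k))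
    (hT : (lbGraph n r s t).IsOptimal F' T) :
    Pending σ z h F ((lbGraph n r s t).switch T (b1 l j)) l := by
  have hF'F : F' ⊆ F := fun f hf => ((hF' f).1 hf).2
  have hav : Available F' := available_of_high hσ fun e he =>
    (hF' e).2 ⟨fun h' => by subst h'; omega, hhigh e he⟩
  have hl : ¬ BChain F' l := fun h' => ((hF' _).1 (h' j)).1 rfl
  have hchain : ∀ i, BChain F' i → ∃ j, AChain F' i j := fun i hi => by
    obtain ⟨j', hj'⟩ := ha i (hi.mono hF'F)
    exact ⟨j', fun k => (hF' _).2 ⟨by simp, (hj' k).1⟩⟩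
  -- Every complete `b`-path of `F'` still has a complete `a`-path, since only a `b`-edge was
  -- removed; so `u` and `w` agree on all levels.
  have heq : ∀ i : Fin n, y T (uAt (i + 1)) = y T (wAt (i + 1)) := fun i =>
    y_u_eq_y_w hT hav hr hs i.2 fun i _ => hchain i
  refine ⟨hhigh, hb, ha l hb, fun j' k hk => ?_, fun i hi hbi => ?_⟩
  · exact a1_not_mem_of_not_bChain hT hav hr hs hl j' k (mem_of_mem_switch hk (by simp))
  · have hbi' : BChain F' i := fun j' => (hF' _).2 ⟨by simp [hi], hbi j'⟩
    refine ⟨fun j' => mem_switch_of_mem (bChain_tree hT hbi' (heq i) j') (by simp [src, hi]), ?_⟩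
    obtain ⟨j', hj'⟩ := ha i hbi
    have hA : AChain F' i j' := fun k => (hF' _).2 ⟨by simp, (hj' k).1⟩
    exact ⟨j', fun k => ⟨mem_switch_of_mem (aChain_tree hT hA hbi' (heq i) k) (by simp [src]),
      (hj' k).2⟩⟩

/-- An edge that belongs to a complete `b`-path is used by an optimal tree. -/
theorem b1_mem_of_isOptimal (hr : 0 < r) (hs : 0 < s) (hav : Available F)
    (ha : ∀ i, BChain F i → ∃ j, AChain F i j) (hB : (lbGraph n r s t).IsOptimal F B) {l : Fin n}
    (hl : BChain F l) (j : Fin (r * s)) : b1 l j ∈ B :=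
  bChain_tree hB hl (y_u_eq_y_w hB hav hr hs l.2 fun i _ => ha i) j

theorem a1_mem_of_isOptimal (hr : 0 < r) (hs : 0 < s) (hav : Available F)
    (ha : ∀ i, BChain F i → ∃ j, AChain F i j) (hB : (lbGraph n r s t).IsOptimal F B) {l : Fin n}
    (hl : BChain F l) {j : Fin r} (hj : AChain F l j) (k : Fin s) : a1 l j k ∈ B :=
  aChain_tree hB hj hl (y_u_eq_y_w hB hav hr hs l.2 fun i _ => ha i) k

theorem Pending.exists_aChain {l : Fin n} (hp : Pending σ z h F B l) (hBF : B ⊆ F) (i : Fin n)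
    (hi : BChain F i) : ∃ j, ∀ k, a1 i j k ∈ F ∧ z ≤ σ (a1 i j k) := by
  by_cases hil : i = l
  · subst hil
    exact hp.aChain_self
  · obtain ⟨-, j, hj⟩ := hp.chains i hil hi
    exact ⟨j, fun k => ⟨hBF (hj k).1, (hj k).2⟩⟩

/-- The complete `a`-path of `F` is unused by `B` and has an edge of index below `h`, which competes
for being first. Hence no edge of index at least `h` is removed while the level is pending. -/
theorem Pending.lt_of_isFirst {l : Fin n} (hp : Pending σ z h F B l) (hσ : WellOrdered σ z h)
    {e : LBEdge n r s t} (he : WeightedDigraph.IsFirst σ F B e) : σ e < h := by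
  obtain ⟨j, hj⟩ := hp.aChain_self
  obtain ⟨k, hk⟩ := hσ.a_lt l j
  exact (he.2.2 _ (hj k).1 (hp.a1_not_mem j k)).trans_lt hk

/-- What happens to a pending level when the first edge is removed: it may stay pending, or its
`b`-path is broken, or the last one of its `a`-paths is broken. -/
theorem Pending.erase_cases {l : Fin n} (hp : Pending σ z h F B l) (hσ : WellOrdered σ z h)
    {e : LBEdge n r s t} {F' : Finset (LBEdge n r s t)} (hBF' : B ⊆ F')
    (he : WeightedDigraph.IsFirst σ F B e) (hF' : ∀ f, f ∈ F' ↔ f ≠ e ∧ f ∈ F) :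
    (Pending σ z h F' B l ∧ ∀ i, BChain F i → BChain F' i) ∨ (∃ j, e = b1 l j) ∨
      (BChain F' l ∧ (∀ j, ¬ AChain F' l j) ∧
        ∃ j k, e = a1 l j k ∧ AChain F l j) := by
  have hhigh : ∀ f, h ≤ σ f → f ∈ F' := fun f hf =>
    (hF' f).2 ⟨fun h' => by subst h'; exact absurd (hp.lt_of_isFirst hσ he) hf.not_gt, hp.high f hf⟩
  have hF'F : F' ⊆ F := fun f hf => ((hF' f).1 hf).2
  by_cases hb : ∃ j, e = b1 l j
  · exact Or.inr (Or.inl hb)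
  push Not at hb
  have hbl : BChain F' l := fun j => (hF' _).2 ⟨(hb j).symm, hp.bChain_self j⟩
  by_cases ha : ∃ j, ∀ k, a1 l j k ∈ F' ∧ z ≤ σ (a1 l j k)
  · refine Or.inl ⟨⟨hhigh, hbl, ha, hp.a1_not_mem, fun i hi hbi =>
      hp.chains i hi (hbi.mono hF'F)⟩, fun i hi => ?_⟩
    by_cases hil : i = l
    · exact hil ▸ hbl
    · exact (hp.chains i hil hi).1.mono hBF'
  · refine Or.inr (Or.inr ⟨hbl, fun j hj => ?_, ?_⟩)
    -- If `e` breaks the path `j₀`, then `σ e ≥ z`. Since `e` comes first and no `a1`-edge of the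
    -- level is in `B`, any other complete `a`-path would also have all indices at least `z`,
    -- contrary to `ha`.
    · obtain ⟨j₀, hj₀⟩ := hp.aChain_self
      obtain ⟨k₀, rfl⟩ : ∃ k, e = a1 l j₀ k := by
        by_contra hne
        push Not at hne
        exact ha ⟨j₀, fun k => ⟨(hF' _).2 ⟨(hne k).symm, (hj₀ k).1⟩, (hj₀ k).2⟩⟩
      exact ha ⟨j, fun k => ⟨hj k, (hj₀ k₀).2.trans
        (he.2.2 _ (hF'F (hj k)) (hp.a1_not_mem j k))⟩⟩
    · obtain ⟨j₀, hj₀⟩ := hp.aChain_self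
      by_contra hne
      push Not at hne
      refine ha ⟨j₀, fun k => ⟨(hF' _).2 ⟨fun h' => ?_, (hj₀ k).1⟩, (hj₀ k).2⟩⟩
      exact hne j₀ k h'.symm fun k => (hj₀ k).1

/-- A call that completes level `l` contains a call that counts with the levels below `l`. -/
theorem exists_ready_of_pending (hr : 0 < r) (hs : 0 < s) (hσ : WellOrdered σ z h)
    (hRF : (lbGraph n r s t).RandomFacet1P σ F B B' k) (hB : (lbGraph n r s t).IsTree B)
    {l : Fin n} (hp : Pending σ z h F B l) :
    ∃ F₃ B₃ B₄ k₃, (lbGraph n r s t).RandomFacet1P σ F₃ B₃ B₄ k₃ ∧ k₃ ≤ k ∧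
      (lbGraph n r s t).IsTree B₃ ∧ Ready σ z h F₃ B₃ l ∧ ∀ i, BChain F i → BChain F₃ i := by
  induction hRF with
  | done B =>
    obtain ⟨j, hj⟩ := hp.aChain_self
    exact absurd (hj ⟨0, hs⟩).1 (hp.a1_not_mem _ _)
  | stay F B B' e k he h₁ hn ih =>
    have hBe := h₁.subset
    have hBe' := (h₁.isOptimal lbGraph_isRanking hB).subset
    -- The returned tree is optimal for all of `F`, so it contains all edges of the complete paths
    -- of level `l`. As it avoids `e`, a refused switch is impossible in the last two cases.
    have hoptF := (WeightedDigraph.RandomFacet1P.stay F B B' e k he h₁ hn).isOptimal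
      lbGraph_isRanking hB
    have hmem := fun f => @Finset.mem_erase _ (fun a b => Classical.propDecidable (a = b)) f e F
    have hav := available_of_high hσ hp.high
    have hA : ∀ i, BChain F i → ∃ j, AChain F i j := fun i hi =>
      (hp.exists_aChain (hBe.trans fun f hf => ((hmem f).1 hf).2) i hi).imp fun j hj k => (hj k).1
    rcases hp.erase_cases hσ hBe he hmem with ⟨hp', hb'⟩ | ⟨j, rfl⟩ | ⟨-, -, j, k, rfl, hj⟩
    · obtain ⟨F₃, B₃, B₄, k₃, hRF, hk, hB₃, hR, hb⟩ := ih hB hp'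
      exact ⟨F₃, B₃, B₄, k₃, hRF, hk, hB₃, hR, fun i hi => hb i (hb' i hi)⟩
    · have := b1_mem_of_isOptimal hr hs hav hA hoptF hp.bChain_self j
      exact absurd rfl ((hmem _).1 (hBe' this)).1
    · have := a1_mem_of_isOptimal hr hs hav hA hoptF hp.bChain_self hj k
      exact absurd rfl ((hmem _).1 (hBe' this)).1
  | step F B B' B'' e k₁ k₂ he h₁ hi h₂ ih₁ ih₂ =>
    have hBe := h₁.subset
    have hopt := h₁.isOptimal lbGraph_isRanking hB
    have hmem := fun f => @Finset.mem_erase _ (fun a b => Classical.propDecidable (a = b)) f e F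
    have hlt := hp.lt_of_isFirst hσ he
    have hA := hp.exists_aChain (hBe.trans fun f hf => ((hmem f).1 hf).2)
    have hB₂ := hopt.isTree.switch lbGraph_isRanking e
    rcases hp.erase_cases hσ hBe he hmem with ⟨hp', hb'⟩ | ⟨j, rfl⟩ | ⟨hbl, hal, j, k, rfl, hj⟩
    · obtain ⟨F₃, B₃, B₄, k₃, hRF, hk, hB₃, hR, hb⟩ := ih₁ hB hp'
      exact ⟨F₃, B₃, B₄, k₃, hRF, by omega, hB₃, hR, fun i hi => hb i (hb' i hi)⟩
    -- The `b`-path was broken before the `a`-paths: once its edge returns, the level is pending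
    -- again in the second call.
    · obtain ⟨F₃, B₃, B₄, k₃, hRF, hk, h⟩ := ih₂ hB₂
        (pending_switch hr hs hσ hmem hp.high hlt hp.bChain_self hA hopt)
      exact ⟨F₃, B₃, B₄, k₃, hRF, by omega, h⟩
    -- The last `a`-path was broken: the tree `B'` has its lower levels reset, and the second call
    -- is the one sought.
    · refine ⟨F, _, B'', k₂, h₂, by omega, hB₂, ⟨hp.high, ?_, hA, ?_⟩, fun i hi => hi⟩
      all_goals
        have hav : Available _ := available_of_high hσ fun f hf => (hmem f).2
          ⟨fun h' => by subst h'; omega, hp.high f hf⟩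
        have heq : ∀ i : Fin n, l ≤ i → y B' (uAt (i + 1)) = y B' (wAt (i + 1)) := fun i hi => by
          refine y_u_eq_y_w hopt hav hr hs i.2 fun i' hi' hbi' => ?_
          have hne : i' ≠ l := by
            rintro rfl
            have : (i' : ℕ) ≤ i := hi
            omega
          obtain ⟨-, j', hj'⟩ := hp.chains i' hne fun j => ((hmem _).1 (hbi' j)).2
          exact ⟨j', fun k => hBe (hj' k).1⟩
      · intro i hil j' hj'
        exact b1_not_mem_of_reset hopt hav hr hs (heq l le_rfl) hbl hal hil j'
          (mem_of_mem_switch hj' (by simp))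
      · intro i hil hbi j'
        refine mem_switch_of_mem (bChain_tree hopt ?_ (heq i hil) j') (by simp [src])
        exact fun j' => (hmem _).2 ⟨by simp, hbi j'⟩

/-- An active level has an unused edge of index below `z`, so the edge removed next also has index
below `z`. -/
theorem Ready.lt_of_isFirst {i : ℕ} (hready : Ready σ z h F B i)
    (hσ : WellOrdered σ z h) {e : LBEdge n r s t} (he : WeightedDigraph.IsFirst σ F B e)
    {l : Fin n} (hl : (l : ℕ) < i) (hb : BChain F l) : σ e < z := by
  obtain ⟨j, hj⟩ := hσ.b_lt l
  exact (he.2.2 _ (hb j) (hready.b1_not_mem l hl j)).trans_lt hj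

/-- The removed edge has index below `z ≤ h`, so it is neither a reserved copy nor on a protected
`a`-path. -/
theorem Ready.erase {i : ℕ} (hready : Ready σ z h F B i)
    (hσ : WellOrdered σ z h) (hzh : z ≤ h) {e : LBEdge n r s t} {F' : Finset (LBEdge n r s t)}
    (he : WeightedDigraph.IsFirst σ F B e) (hF' : ∀ f, f ∈ F' ↔ f ≠ e ∧ f ∈ F)
    {l : Fin n} (hl : (l : ℕ) < i) (hb : BChain F l) : Ready σ z h F' B i := by
  have hlt := hready.lt_of_isFirst hσ he hl hb
  have hF'F : F' ⊆ F := fun f hf => ((hF' f).1 hf).2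
  refine ⟨fun f hf => (hF' f).2 ⟨fun h' => by subst h'; omega, hready.high f hf⟩,
    hready.b1_not_mem, fun i' hi' => ?_, fun i' hi' hb' => hready.bChain i' hi' (hb'.mono hF'F)⟩
  obtain ⟨j, hj⟩ := hready.aChain i' (hi'.mono hF'F)
  exact ⟨j, fun k => ⟨(hF' _).2 ⟨fun h' => by have := (hj k).2; subst h'; omega, (hj k).1⟩,
    (hj k).2⟩⟩

/-- The number of switches performed by a call that counts with the levels below `i`. -/
theorem card_antitoneSets_le_of_ready (hr : 0 < r) (hs : 0 < s) (hσ : WellOrdered σ z h)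
    (hzh : z ≤ h) (i : ℕ) (hRF : (lbGraph n r s t).RandomFacet1P σ F B B' k)
    (hB : (lbGraph n r s t).IsTree B) (hready : Ready σ z h F B i) (N : Finset (Fin n))
    (hN : ∀ i' ∈ N, (i' : ℕ) < i ∧ BChain F i') :
    (antitoneSets (completion σ) N).card ≤ k + 1 := by
  -- The outer induction serves the nested call that counts below `l < i`; the inner one follows the
  -- run.
  induction i using Nat.strong_induction_on generalizing F B B' k N with
  | _ i ihi =>
  induction hRF generalizing N with
  | done B =>
    obtain rfl : N = ∅ := by
      refine Finset.eq_empty_of_forall_notMem fun i' hi' => ?_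
      exact hready.b1_not_mem i' (hN i' hi').1 ⟨0, Nat.mul_pos hr hs⟩ ((hN i' hi').2 _)
    rw [card_antitoneSets_empty]
  | stay F B B' e k he h₁ hn ih =>
    have hmem := fun f => @Finset.mem_erase _ (fun a b => Classical.propDecidable (a = b)) f e F
    rcases N.eq_empty_or_nonempty with rfl | ⟨l, hl⟩
    · rw [card_antitoneSets_empty]
      omega
    refine ih hB (hready.erase hσ hzh he hmem (hN l hl).1 (hN l hl).2) N
      fun i' hi' => ⟨(hN i' hi').1, fun j => (hmem _).2 ⟨fun hj => ?_, (hN i' hi').2 j⟩⟩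
    -- An edge of an active `b`-path belongs to every optimal tree for `F`, so its switch cannot be
    -- refused.
    subst hj
    have hBF := (h₁.isOptimal lbGraph_isRanking hB).subset
    have hoptF := (WeightedDigraph.RandomFacet1P.stay F B B' _ k he h₁ hn).isOptimal
      lbGraph_isRanking hB
    have := b1_mem_of_isOptimal hr hs (available_of_high hσ hready.high)
      (fun i hi => (hready.aChain i hi).imp fun j hj k => (hj k).1) hoptF (hN i' hi').2 j
    exact ((hmem _).1 (hBF this)).1 rfl
  | step F B B' B'' e k₁ k₂ he h₁ hi h₂ ih₁ ih₂ =>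
    have hmem := fun f => @Finset.mem_erase _ (fun a b => Classical.propDecidable (a = b)) f e F
    rcases N.eq_empty_or_nonempty with rfl | ⟨l₀, hl₀⟩
    · rw [card_antitoneSets_empty]
      omega
    have hlt := hready.lt_of_isFirst hσ he (hN l₀ hl₀).1 (hN l₀ hl₀).2
    have hready' := hready.erase hσ hzh he hmem (hN l₀ hl₀).1 (hN l₀ hl₀).2
    by_cases hex : ∃ l ∈ N, ∃ j, e = b1 l j
    · obtain ⟨l, hl, j, rfl⟩ := hex
      -- All `b1`-edges of active levels lie in `F` and outside `B`, so the first edge has the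
      -- smallest index among them.
      have hmin : ∀ i' ∈ N, completion σ l ≤ completion σ i' := fun i' hi' => by
        obtain ⟨j', hj'⟩ := exists_completion_eq hr hs σ i'
        rw [← hj']
        exact (completion_le σ l j).trans
          (he.2.2 _ ((hN i' hi').2 j') (hready.b1_not_mem i' (hN i' hi').1 j'))
      have hcard₁ := ih₁ hB hready' (N.erase l) fun i' hi' => by
        rw [Finset.mem_erase] at hi'
        exact ⟨(hN i' hi'.2).1, fun j' => (hmem _).2 ⟨by simp [hi'.1], (hN i' hi'.2).2 j'⟩⟩
      have hopt := h₁.isOptimal lbGraph_isRanking hB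
      -- Setting level `l` makes the second call pending, and the call that counts below `l` lies
      -- inside it. The switch itself pays for the second `+ 1`, as `(k₁ + 1) + (k₃ + 1) ≤ (k₁ + 1 +
      -- k₂) + 1`.
      obtain ⟨F₃, B₃, B₄, k₃, hRF, hk₃, hB₃, hR, hb⟩ :=
        exists_ready_of_pending hr hs hσ h₂ (hopt.isTree.switch lbGraph_isRanking _)
          (pending_switch hr hs hσ hmem hready.high (hlt.trans_le hzh) (hN l hl).2 hready.aChain
            hopt)
      have hcard₃ := ihi l (hN l hl).1 hRF hB₃ hR (N.filter (· < l)) fun i' hi' => by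
        rw [Finset.mem_filter] at hi'
        exact ⟨hi'.2, hb i' (hN i' hi'.1).2⟩
      have := card_antitoneSets_le (completion σ) hmin
      omega
    · push Not at hex
      have := ih₁ hB hready' N fun i' hi' =>
        ⟨(hN i' hi').1, fun j => (hmem _).2 ⟨(hex i' hi' j).symm, (hN i' hi').2 j⟩⟩
      omega

theorem card_antitoneSets_le_numSwitches (hr : 0 < r) (hs : 0 < s) (hσ : WellOrdered σ z h)
    (hzh : z ≤ h) (hB : (lbGraph n r s t).IsTree B) (hB₀ : ∀ e ∈ B, e.IsZeroEdge) :
    (antitoneSets (completion σ) Finset.univ).card ≤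
      (lbGraph n r s t).numSwitches σ Finset.univ B + 1 := by
  have := Fintype.ofFinite (LBVertex n r s)
  obtain ⟨B', hRF⟩ := WeightedDigraph.exists_randomFacet1P_numSwitches
    (lbGraph_isRanking.exists_randomFacet1P σ (Finset.subset_univ B) hB)
  refine card_antitoneSets_le_of_ready hr hs hσ hzh n hRF hB ⟨fun e _ => Finset.mem_univ e,
    fun i _ j hj => hB₀ _ hj, fun i _ => ?_, fun i hi => absurd i.2 hi.not_gt⟩ _
    fun i _ => ⟨i.2, fun j => Finset.mem_univ _⟩
  exact (hσ.le_a i).imp fun j hj k => ⟨Finset.mem_univ _, hj k⟩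

end

end LBGraph

/-! ### Uniformly random bijections -/

section Prob

variable {Ω : Type*} [Fintype Ω]

open Classical in
/-- The probability of an event under the uniform distribution on a finite type. -/
noncomputable def prob (P : Ω → Prop) : ℝ := (Finset.univ.filter P).card / Fintype.card Ω

theorem prob_eq (P : Ω → Prop) [DecidablePred P] :
    prob P = (Finset.univ.filter P).card / Fintype.card Ω := by
  unfold prob
  congr!

theorem prob_mono {P Q : Ω → Prop} (h : ∀ ω, P ω → Q ω) : prob P ≤ prob Q := by
  classical
  simp only [prob_eq]
  gcongr with ω
  exact h ω

theorem prob_or_le (P Q : Ω → Prop) : prob (fun ω => P ω ∨ Q ω) ≤ prob P + prob Q := by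
  classical
  simp only [prob_eq]
  rw [← add_div]
  gcongr
  rw [Finset.filter_or]
  exact_mod_cast Finset.card_union_le _ _

theorem prob_or_le_of_le {P Q : Ω → Prop} {x y : ℝ} (hP : prob P ≤ x) (hQ : prob Q ≤ y) :
    prob (fun ω => P ω ∨ Q ω) ≤ x + y :=
  (prob_or_le P Q).trans (add_le_add hP hQ)

theorem prob_exists_le {ι : Type*} [Fintype ι] (P : ι → Ω → Prop) :
    prob (fun ω => ∃ i, P i ω) ≤ ∑ i, prob (P i) := by
  classical
  simp only [prob_eq]
  rw [← Finset.sum_div]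
  gcongr
  have : Finset.univ.filter (fun ω => ∃ i, P i ω) =
      Finset.univ.biUnion fun i => Finset.univ.filter (P i) := by
    ext
    simp
  rw [this]
  exact_mod_cast Finset.card_biUnion_le

theorem prob_exists_le_mul {ι : Type*} [Fintype ι] (P : ι → Ω → Prop) {x : ℝ}
    (h : ∀ i, prob (P i) ≤ x) : prob (fun ω => ∃ i, P i ω) ≤ Fintype.card ι * x := by
  refine (prob_exists_le P).trans ((Finset.sum_le_sum fun i _ => h i).trans ?_)
  simp

theorem one_le_prob_add_prob_not [Nonempty Ω] (P : Ω → Prop) :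
    1 ≤ prob P + prob (fun ω => ¬ P ω) := by
  classical
  have h : (0 : ℝ) < Fintype.card Ω := by exact_mod_cast Fintype.card_pos
  simp only [prob_eq]
  rw [← add_div, one_le_div h]
  have := Finset.card_filter_add_card_filter_not (s := (Finset.univ : Finset Ω)) P
  rw [Finset.card_univ] at this
  exact_mod_cast this.ge

theorem prob_comp_equiv (φ : Ω ≃ Ω) (P : Ω → Prop) : prob (fun ω => P (φ ω)) = prob P := by
  classical
  simp only [prob_eq]
  congr 2
  refine Finset.card_bij (fun ω _ => φ ω) (by simp) (fun _ _ _ _ h => φ.injective h) fun ω hω => ?_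
  exact ⟨φ.symm ω, by simpa using hω, by simp⟩

variable {E α : Type*} [Fintype E] [Fintype α] [Fintype (E ≃ α)]

open Classical in
-- Sampling without replacement: given that `A` is mapped into `S`, a further edge lands in `S` with
-- probability `(|S| - |A|) / (|α| - |A|)`, which is at most `|S| / |α|`. The count is a double
-- count of pairs of an edge outside `A` and a bijection sending it into `S`.
theorem card_filter_insert_mul_le (S : Finset α) (A : Finset E) {e : E} (he : e ∉ A) :
    (Finset.univ.filter fun σ : E ≃ α => ∀ f ∈ insert e A, σ f ∈ S).card * Fintype.card α ≤
      S.card * (Finset.univ.filter fun σ : E ≃ α => ∀ f ∈ A, σ f ∈ S).card := by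
  set X := (Finset.univ.filter fun σ : E ≃ α => ∀ f ∈ insert e A, σ f ∈ S).card with hX
  set P := Finset.univ.filter fun σ : E ≃ α => ∀ f ∈ A, σ f ∈ S with hP
  rcases P.eq_empty_or_nonempty with h0 | ⟨σ₀, hσ₀⟩
  · have : X = 0 := by
      rw [hX, Finset.card_eq_zero, Finset.filter_eq_empty_iff]
      intro σ _ hσ
      have : σ ∈ P := Finset.mem_filter.2 ⟨Finset.mem_univ _, fun f hf =>
        hσ f (Finset.mem_insert_of_mem hf)⟩
      rw [h0] at this
      exact Finset.notMem_empty _ this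
    rw [this, Nat.zero_mul]
    exact Nat.zero_le _
  have hcard : Fintype.card E = Fintype.card α := Fintype.card_congr σ₀
  have hcount : ∀ σ ∈ P, (Aᶜ.filter fun e' => σ e' ∈ S).card + A.card = S.card := by
    intro σ hσ
    have hσA := (Finset.mem_filter.1 hσ).2
    have h₁ : (Finset.univ.filter fun e' => σ e' ∈ S).card = S.card := by
      refine Finset.card_bij (fun e' _ => σ e') (by simp) (fun _ _ _ _ h => σ.injective h)
        fun x hx => ⟨σ.symm x, by simpa using hx, by simp⟩
    rw [← h₁, ← Finset.card_union_of_disjoint]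
    · congr 1
      ext e'
      simp only [Finset.mem_union, Finset.mem_filter, Finset.mem_compl, Finset.mem_univ, true_and]
      by_cases h : e' ∈ A
      · simp [h, hσA e' h]
      · simp [h]
    · rw [Finset.disjoint_left]
      intro e' h h'
      exact Finset.mem_compl.1 (Finset.mem_filter.1 h).1 h'
  -- Composition with the transposition of `e` and `e'` fixes `A`, so all edges outside `A` are
  -- equally likely to land in `S`.
  have hswap : ∀ e' ∈ Aᶜ, (P.filter fun σ => σ e' ∈ S).card = X := by
    intro e' he'
    rw [Finset.mem_compl] at he'
    have hfix : ∀ f ∈ A, Equiv.swap e e' f = f := fun f hf =>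
      Equiv.swap_apply_of_ne_of_ne (fun h => he (h ▸ hf)) (fun h => he' (h ▸ hf))
    refine Finset.card_bij (fun σ _ => (Equiv.swap e e').trans σ) ?_ ?_ ?_
    · intro σ hσ
      simp only [hP, Finset.mem_filter, Finset.mem_univ, true_and] at hσ
      simp only [Finset.mem_filter, Finset.mem_univ, true_and, Finset.mem_insert, forall_eq_or_imp,
        Equiv.trans_apply, Equiv.swap_apply_left]
      exact ⟨hσ.2, fun f hf => by rw [hfix f hf]; exact hσ.1 f hf⟩
    · intro σ _ τ _ h
      have := congrArg (fun ρ => (Equiv.swap e e').trans ρ) h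
      simpa [← Equiv.trans_assoc] using this
    · intro σ hσ
      simp only [Finset.mem_filter, Finset.mem_univ, true_and, Finset.mem_insert,
        forall_eq_or_imp] at hσ
      refine ⟨(Equiv.swap e e').trans σ, ?_, by simp [← Equiv.trans_assoc]⟩
      simp only [hP, Finset.mem_filter, Finset.mem_univ, true_and, Equiv.trans_apply,
        Equiv.swap_apply_right]
      exact ⟨fun f hf => by rw [hfix f hf]; exact hσ.2 f hf, hσ.1⟩
  have hdouble : Aᶜ.card * X = P.card * (S.card - A.card) := by
    have := Finset.sum_card_bipartiteAbove_eq_sum_card_bipartiteBelow (s := Aᶜ) (t := P)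
      fun e' σ => σ e' ∈ S
    unfold Finset.bipartiteAbove Finset.bipartiteBelow at this
    rw [Finset.sum_congr rfl hswap, Finset.sum_const, smul_eq_mul] at this
    rw [this, ← smul_eq_mul, ← Finset.sum_const]
    refine Finset.sum_congr rfl fun σ hσ => ?_
    have := hcount σ hσ
    simp only
    omega
  have hpos : 0 < Aᶜ.card := Finset.card_pos.2 ⟨e, Finset.mem_compl.2 he⟩
  have hAS : A.card ≤ S.card := by have := hcount σ₀ hσ₀; omega
  have hSα : S.card ≤ Fintype.card α := Finset.card_le_univ S
  have hAc : Aᶜ.card + A.card = Fintype.card α := by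
    rw [← hcard, Finset.card_compl]
    exact Nat.sub_add_cancel (Finset.card_le_univ A)
  obtain ⟨d, hd⟩ := Nat.exists_eq_add_of_le hAS
  rw [hd, Nat.add_sub_cancel_left] at hdouble
  refine Nat.le_of_mul_le_mul_left ?_ hpos
  calc Aᶜ.card * (X * Fintype.card α) = P.card * (d * Fintype.card α) := by
        rw [← mul_assoc, hdouble, mul_assoc]
    _ ≤ P.card * (S.card * Aᶜ.card) := by
        refine Nat.mul_le_mul_left _ ?_
        rw [← hAc, hd]
        have : d ≤ Aᶜ.card := by omega
        nlinarith
    _ = Aᶜ.card * (S.card * P.card) := by ring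

/-- A random bijection maps `A` into `S` with probability at most `(|S| / |α|) ^ |A|`. -/
theorem prob_forall_mem_le [Nonempty α] (S : Finset α) (A : Finset E) :
    prob (fun σ : E ≃ α => ∀ f ∈ A, σ f ∈ S) ≤ ((S.card : ℝ) / Fintype.card α) ^ A.card := by
  classical
  have hα : (0 : ℝ) < Fintype.card α := by exact_mod_cast Fintype.card_pos
  induction A using Finset.induction_on with
  | empty =>
    simp only [prob_eq]
    simp only [Finset.card_empty, pow_zero]
    exact div_le_one_of_le₀ (by exact_mod_cast Finset.card_le_univ _) (by positivity)
  | insert e A he ih =>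
    rw [Finset.card_insert_of_notMem he, pow_succ]
    refine le_trans ?_ (mul_le_mul_of_nonneg_right ih (by positivity))
    simp only [prob_eq]
    rw [div_mul_div_comm]
    have h := card_filter_insert_mul_le S A he
    have h' : ((Finset.univ.filter fun σ : E ≃ α => ∀ f ∈ insert e A, σ f ∈ S).card : ℝ) *
      Fintype.card α ≤ S.card * (Finset.univ.filter fun σ : E ≃ α => ∀ f ∈ A, σ f ∈ S).card := by
      exact_mod_cast h
    rcases (Nat.cast_nonneg (Fintype.card (E ≃ α)) : (0 : ℝ) ≤ _).eq_or_lt with h0 | h0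
    · rw [← h0]
      simp
    · rw [div_le_div_iff₀ h0 (by positivity)]
      have := mul_le_mul_of_nonneg_right h' h0.le
      linarith

theorem prob_forall_mem_le_of_injective [Nonempty α] {ι : Type*} [Fintype ι] {g : ι → E}
    (hg : Function.Injective g) (S : Finset α) :
    prob (fun σ : E ≃ α => ∀ i, σ (g i) ∈ S) ≤
      ((S.card : ℝ) / Fintype.card α) ^ Fintype.card ι := by
  classical
  have h := prob_forall_mem_le S (Finset.univ.image g)
  rw [Finset.card_image_of_injective _ hg, Finset.card_univ] at h
  refine le_trans (prob_mono fun σ hσ => ?_) h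
  simpa using hσ

variable {M : ℕ} [Fintype (E ≃ Fin M)]

theorem prob_forall_lt_le [NeZero M] {ι : Type*} [Fintype ι] {g : ι → E}
    (hg : Function.Injective g) {h : ℕ} (hh : h ≤ M) :
    prob (fun σ : E ≃ Fin M => ∀ i, (σ (g i) : ℕ) < h) ≤ ((h : ℝ) / M) ^ Fintype.card ι := by
  have := prob_forall_mem_le_of_injective hg (Finset.univ.filter fun x : Fin M => (x : ℕ) < h)
  rw [Fin.card_filter_val_lt, min_eq_right hh, Fintype.card_fin] at this
  simpa using this

theorem prob_forall_ge_le [NeZero M] {ι : Type*} [Fintype ι] {g : ι → E}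
    (hg : Function.Injective g) {h : ℕ} (hh : h ≤ M) :
    prob (fun σ : E ≃ Fin M => ∀ i, h ≤ (σ (g i) : ℕ)) ≤
      (((M - h : ℕ) : ℝ) / M) ^ Fintype.card ι := by
  have := prob_forall_mem_le_of_injective hg (Finset.univ.filter fun x : Fin M => h ≤ (x : ℕ))
  have hc : (Finset.univ.filter fun x : Fin M => h ≤ (x : ℕ)).card = M - h := by
    have h₁ := Finset.card_filter_add_card_filter_not (s := (Finset.univ : Finset (Fin M)))
      fun x => (x : ℕ) < h
    rw [Fin.card_filter_val_lt, min_eq_right hh, Finset.card_univ, Fintype.card_fin] at h₁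
    simp only [not_lt] at h₁
    omega
  rw [hc, Fintype.card_fin] at this
  simpa using this

end Prob

/-! ### Well-ordered permutations -/

namespace LBGraph

section

variable {M : ℕ} [Fintype (LBEdge n r s t ≃ Fin M)]

theorem not_wellOrdered {σ : LBEdge n r s t → ℕ} {z h : ℕ} (hσ : ¬ WellOrdered σ z h) :
    (∃ x : Fin n × Fin r × Fin s, ∀ l, σ (a0 x.1 x.2.1 x.2.2 l) < h) ∨
    (∃ x : Fin n × Fin (r * s), ∀ l, σ (b0 x.1 x.2 l) < h) ∨
    (∃ i, ∀ l, σ (u1 i l) < h) ∨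
    (∃ i, ∀ l, σ (u0 i l) < h) ∨
    (∃ x : Fin n × Fin r, ∀ l, σ (w1 x.1 x.2 l) < h) ∨
    (∃ i, ∀ l, σ (w0 i l) < h) ∨
    (∃ x : Fin n × Fin r, ∀ k, h ≤ σ (a1 x.1 x.2 k)) ∨
    (∃ i, ∀ j, z ≤ σ (b1 i j)) ∨
    (∃ x : Fin n × (Fin r → Fin s), ∀ j, σ (a1 x.1 j (x.2 j)) < z) := by
  by_contra hc
  simp only [not_or, not_exists, not_forall, not_lt, not_le] at hc
  obtain ⟨h₁, h₂, h₃, h₄, h₅, h₆, h₇, h₈, h₉⟩ := hc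
  refine hσ ⟨⟨fun i j k => ?_, fun i j => ?_, fun i => ?_, fun i => ?_, fun i j => ?_,
    fun i => ?_⟩, fun i j => h₇ (i, j), h₈, fun i => ?_⟩
  · simpa using h₁ (i, j, k)
  · simpa using h₂ (i, j)
  · simpa using h₃ i
  · simpa using h₄ i
  · simpa using h₅ (i, j)
  · simpa using h₆ i
  -- If every `a`-path of a level has an index below `z`, a choice function selects one such edge
  -- per path; the union bound then runs over the `s ^ r` choice functions.
  · by_contra hi
    push Not at hi
    choose κ hκ using hi
    obtain ⟨j, hj⟩ := h₉ (i, κ)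
    exact absurd (hκ j) hj.not_gt

theorem prob_not_wellOrdered_le [NeZero M] {z h : ℕ} (hz : z ≤ M) (hh : h ≤ M) :
    prob (fun σ : LBEdge n r s t ≃ Fin M => ¬ WellOrdered (fun e => (σ e : ℕ)) z h) ≤
      (n * (r * s) + n * (r * s) + n + n + n * r + n) * ((h : ℝ) / M) ^ t +
      n * r * (((M - h : ℕ) : ℝ) / M) ^ s + n * (((M - z : ℕ) : ℝ) / M) ^ (r * s) +
      n * s ^ r * ((z : ℝ) / M) ^ r := by
  refine (prob_mono fun σ => not_wellOrdered).trans ?_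
  have h₁ := prob_exists_le_mul (fun (x : Fin n × Fin r × Fin s) (σ : LBEdge n r s t ≃ Fin M) =>
    ∀ l, (σ (a0 x.1 x.2.1 x.2.2 l) : ℕ) < h) fun x =>
      prob_forall_lt_le (fun _ _ h => by simpa using h) hh
  have h₂ := prob_exists_le_mul (fun (x : Fin n × Fin (r * s)) (σ : LBEdge n r s t ≃ Fin M) =>
    ∀ l, (σ (b0 x.1 x.2 l) : ℕ) < h) fun x =>
      prob_forall_lt_le (fun _ _ h => by simpa using h) hh
  have h₃ := prob_exists_le_mul (fun (i : Fin n) (σ : LBEdge n r s t ≃ Fin M) =>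
    ∀ l, (σ (u1 i l) : ℕ) < h) fun x => prob_forall_lt_le (fun _ _ h => by simpa using h) hh
  have h₄ := prob_exists_le_mul (fun (i : Fin n) (σ : LBEdge n r s t ≃ Fin M) =>
    ∀ l, (σ (u0 i l) : ℕ) < h) fun x => prob_forall_lt_le (fun _ _ h => by simpa using h) hh
  have h₅ := prob_exists_le_mul (fun (x : Fin n × Fin r) (σ : LBEdge n r s t ≃ Fin M) =>
    ∀ l, (σ (w1 x.1 x.2 l) : ℕ) < h) fun x =>
      prob_forall_lt_le (fun _ _ h => by simpa using h) hh
  have h₆ := prob_exists_le_mul (fun (i : Fin n) (σ : LBEdge n r s t ≃ Fin M) =>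
    ∀ l, (σ (w0 i l) : ℕ) < h) fun x => prob_forall_lt_le (fun _ _ h => by simpa using h) hh
  have h₇ := prob_exists_le_mul (fun (x : Fin n × Fin r) (σ : LBEdge n r s t ≃ Fin M) =>
    ∀ k, h ≤ (σ (a1 x.1 x.2 k) : ℕ)) fun x =>
      prob_forall_ge_le (fun _ _ h => by simpa using h) hh
  have h₈ := prob_exists_le_mul (fun (i : Fin n) (σ : LBEdge n r s t ≃ Fin M) =>
    ∀ j, z ≤ (σ (b1 i j) : ℕ)) fun x => prob_forall_ge_le (fun _ _ h => by simpa using h) hz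
  have h₉ := prob_exists_le_mul (fun (x : Fin n × (Fin r → Fin s))
      (σ : LBEdge n r s t ≃ Fin M) => ∀ j, (σ (a1 x.1 j (x.2 j)) : ℕ) < z) fun x =>
      prob_forall_lt_le (fun j j' h => by simp only [a1.injEq] at h; exact h.2.1) hz
  simp only [Fintype.card_prod, Fintype.card_fin, Fintype.card_fun, Nat.cast_mul,
    Nat.cast_pow] at h₁ h₂ h₃ h₄ h₅ h₆ h₇ h₈ h₉
  refine (prob_or_le_of_le h₁ (prob_or_le_of_le h₂ (prob_or_le_of_le h₃ (prob_or_le_of_le h₄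
    (prob_or_le_of_le h₅ (prob_or_le_of_le h₆ (prob_or_le_of_le h₇
      (prob_or_le_of_le h₈ h₉)))))))).trans (le_of_eq ?_)
  ring

end

/-! ### Permuting the levels -/

/-- The permutation of the edges induced by a permutation of the levels. -/
def mapLevel (π : Equiv.Perm (Fin n)) : LBEdge n r s t ≃ LBEdge n r s t where
  toFun
    | a1 i j k => a1 (π i) j k
    | a0 i j k l => a0 (π i) j k l
    | b1 i j => b1 (π i) j
    | b0 i j l => b0 (π i) j l
    | u1 i l => u1 (π i) l
    | u0 i l => u0 (π i) l
    | w1 i j l => w1 (π i) j l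
    | w0 i l => w0 (π i) l
  invFun
    | a1 i j k => a1 (π.symm i) j k
    | a0 i j k l => a0 (π.symm i) j k l
    | b1 i j => b1 (π.symm i) j
    | b0 i j l => b0 (π.symm i) j l
    | u1 i l => u1 (π.symm i) l
    | u0 i l => u0 (π.symm i) l
    | w1 i j l => w1 (π.symm i) j l
    | w0 i l => w0 (π.symm i) l
  left_inv e := by cases e <;> simp
  right_inv e := by cases e <;> simp

/-- The conditions treat all levels alike. The map need not preserve the costs: it acts only on the
distribution of indices. -/
theorem WellOrdered.comp_mapLevel {σ : LBEdge n r s t → ℕ} {z h : ℕ} (hσ : WellOrdered σ z h)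
    (π : Equiv.Perm (Fin n)) : WellOrdered (fun e => σ (mapLevel π e)) z h where
  available := by
    have key : ∀ e : LBEdge n r s t, mapLevel π e ∈ Finset.univ.filter (fun e => h ≤ σ e) →
        e ∈ Finset.univ.filter fun e => h ≤ σ (mapLevel π e) := fun e he =>
      Finset.mem_filter.2 ⟨Finset.mem_univ e, (Finset.mem_filter.1 he).2⟩
    refine ⟨fun i j k => ?_, fun i j => ?_, fun i => ?_, fun i => ?_, fun i j => ?_, fun i => ?_⟩
    · exact (hσ.available.a0 (π i) j k).imp fun l hl => key _ hl
    · exact (hσ.available.b0 (π i) j).imp fun l hl => key _ hl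
    · exact (hσ.available.u1 (π i)).imp fun l hl => key _ hl
    · exact (hσ.available.u0 (π i)).imp fun l hl => key _ hl
    · exact (hσ.available.w1 (π i) j).imp fun l hl => key _ hl
    · exact (hσ.available.w0 (π i)).imp fun l hl => key _ hl
  a_lt i := hσ.a_lt (π i)
  b_lt i := hσ.b_lt (π i)
  le_a i := hσ.le_a (π i)

theorem completion_injective (hr : 0 < r) (hs : 0 < s) {σ : LBEdge n r s t → ℕ}
    (hσ : Function.Injective σ) : Function.Injective (completion σ) := by
  intro i i' h
  obtain ⟨j, hj⟩ := exists_completion_eq hr hs σ i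
  obtain ⟨j', hj'⟩ := exists_completion_eq hr hs σ i'
  have := hσ ((hj.trans h).trans hj'.symm)
  simp only [b1.injEq] at this
  exact this.1

/-- Some permutation of the levels in `S` sorts the completion indices. -/
theorem exists_perm_sorting (S : Finset (Fin n)) {β : Fin n → ℕ} (hβ : Function.Injective β) :
    ∃ τ : Equiv.Perm (Fin S.card), ∀ i ∈ S, ∀ j ∈ S, i < j →
      β (τ.extendDomain (S.orderIsoOfFin rfl).toEquiv j) <
        β (τ.extendDomain (S.orderIsoOfFin rfl).toEquiv i) := by
  set o := S.orderIsoOfFin rfl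
  let f : Fin S.card → ℕᵒᵈ := fun a => OrderDual.toDual (β (o a))
  refine ⟨Tuple.sort f, fun i hi j hj hij => ?_⟩
  obtain ⟨a, ha⟩ := o.surjective ⟨i, hi⟩
  obtain ⟨b, hb⟩ := o.surjective ⟨j, hj⟩
  have hi' : i = o.toEquiv a := by
    change i = (o a : Fin n)
    rw [ha]
  have hj' : j = o.toEquiv b := by
    change j = (o b : Fin n)
    rw [hb]
  have hab : a < b := by
    rw [← o.lt_iff_lt, ha, hb]
    exact hij
  refine lt_of_le_of_ne ?_ fun h => ?_
  · rw [hi', hj', Equiv.Perm.extendDomain_apply_image, Equiv.Perm.extendDomain_apply_image]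
    exact Tuple.monotone_sort f hab.le
  · exact hij.ne' (Equiv.injective _ (hβ h))

/-- Symmetrization: every well-ordered bijection becomes decreasing along `S` after one of the
`|S|!` rearrangements of the levels in `S`, and each rearrangement preserves the uniform
distribution and `WellOrdered`. No independence of the two events is needed. -/
theorem prob_wellOrdered_le {M : ℕ} [Fintype (LBEdge n r s t ≃ Fin M)] (hr : 0 < r) (hs : 0 < s)
    (z h : ℕ) (S : Finset (Fin n)) :
    prob (fun σ : LBEdge n r s t ≃ Fin M => WellOrdered (fun e => (σ e : ℕ)) z h) ≤
      S.card.factorial * prob (fun σ : LBEdge n r s t ≃ Fin M =>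
        WellOrdered (fun e => (σ e : ℕ)) z h ∧
          S ∈ antitoneSets (completion fun e => (σ e : ℕ)) Finset.univ) := by
  set Q := fun σ : LBEdge n r s t ≃ Fin M => WellOrdered (fun e => (σ e : ℕ)) z h ∧
          S ∈ antitoneSets (completion fun e => (σ e : ℕ)) Finset.univ with hQ
  let π : Equiv.Perm (Fin S.card) → Equiv.Perm (Fin n) := fun τ =>
    τ.extendDomain (S.orderIsoOfFin rfl).toEquiv
  let φ : Equiv.Perm (Fin S.card) → (LBEdge n r s t ≃ Fin M) ≃ (LBEdge n r s t ≃ Fin M) := fun τ =>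
    { toFun := fun σ => (mapLevel (π τ)).trans σ
      invFun := fun σ => (mapLevel (π τ)).symm.trans σ
      left_inv := fun σ => by simp [← Equiv.trans_assoc]
      right_inv := fun σ => by simp [← Equiv.trans_assoc] }
  have h₁ := prob_exists_le_mul (fun (τ : Equiv.Perm (Fin S.card)) σ => Q (φ τ σ))
    fun τ => (prob_comp_equiv (φ τ) Q).le
  rw [Fintype.card_perm, Fintype.card_fin] at h₁
  refine (prob_mono fun σ hσ => ?_).trans h₁
  have hinj : Function.Injective fun e => (σ e : ℕ) := Fin.val_injective.comp σ.injective
  obtain ⟨τ, hτ⟩ := exists_perm_sorting S (completion_injective hr hs hinj)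
  refine ⟨τ, hσ.comp_mapLevel (π τ), ?_⟩
  simp only [antitoneSets, Finset.mem_filter, Finset.mem_powerset, Finset.subset_univ, true_and]
  exact hτ

open Classical in
/-- The expected number of switches is at least the expected number of decreasing subsequences of
length `k`. -/
theorem le_expectedSwitches (hr : 0 < r) (hs : 0 < s) {z h : ℕ} (hzh : z ≤ h) {k : ℕ} (hk : 0 < k)
    {B : Finset (LBEdge n r s t)} (hB : (lbGraph n r s t).IsTree B)
    (hB₀ : ∀ e ∈ B, e.IsZeroEdge) :
    n.choose k / k.factorial *
      prob (fun σ : LBEdge n r s t ≃ Fin (Fintype.card (LBEdge n r s t)) =>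
        WellOrdered (fun e => (σ e : ℕ)) z h) ≤ (lbGraph n r s t).expectedSwitches B := by
  set Q : Finset (Fin n) → (LBEdge n r s t ≃ Fin (Fintype.card (LBEdge n r s t))) → Prop :=
    fun S σ => WellOrdered (fun e => (σ e : ℕ)) z h ∧
      S ∈ antitoneSets (completion fun e => (σ e : ℕ)) Finset.univ with hQ
  have h₁ : ∀ σ : LBEdge n r s t ≃ Fin (Fintype.card (LBEdge n r s t)),
      ((Finset.univ.powersetCard k).filter fun S => Q S σ).card ≤
        (lbGraph n r s t).numSwitches (fun e => (σ e : ℕ)) Finset.univ B := by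
    intro σ
    by_cases hσ : WellOrdered (fun e => (σ e : ℕ)) z h
    · have h₂ := card_antitoneSets_le_numSwitches hr hs hσ hzh hB hB₀
      -- As `k > 0`, the empty set is not counted here; discarding it removes the `+ 1` in the bound
      -- on the switches.
      have h₃ : (Finset.univ.powersetCard k).filter (fun S => Q S σ) ⊆
          (antitoneSets (completion fun e => (σ e : ℕ)) Finset.univ).erase ∅ := by
        intro S hS
        rw [Finset.mem_filter, Finset.mem_powersetCard] at hS
        refine Finset.mem_erase.2 ⟨?_, hS.2.2⟩
        rintro rfl
        rw [Finset.card_empty] at hS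
        omega
      have h₄ := Finset.card_le_card h₃
      rw [Finset.card_erase_of_mem (by simp [antitoneSets])] at h₄
      omega
    · rw [Finset.filter_false_of_mem fun S _ h => hσ h.1, Finset.card_empty]
      exact Nat.zero_le _
  have h₂ : ∑ S ∈ Finset.univ.powersetCard k, prob (Q S) ≤
      (lbGraph n r s t).expectedSwitches B := by
    have hE : (lbGraph n r s t).expectedSwitches B =
        (∑ σ : LBEdge n r s t ≃ Fin (Fintype.card (LBEdge n r s t)),
          ((lbGraph n r s t).numSwitches (fun e => (σ e : ℕ)) Finset.univ B : ℝ)) /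
          Fintype.card (LBEdge n r s t ≃ Fin (Fintype.card (LBEdge n r s t))) := by
      unfold WeightedDigraph.expectedSwitches
      congr!
    rw [hE]
    simp only [prob_eq]
    rw [← Finset.sum_div]
    gcongr
    have := Finset.sum_card_bipartiteAbove_eq_sum_card_bipartiteBelow
      (s := Finset.univ.powersetCard k) (t := Finset.univ) Q
    unfold Finset.bipartiteAbove Finset.bipartiteBelow at this
    have h₃ := Finset.sum_le_sum fun σ (_ : σ ∈ Finset.univ) => h₁ σ
    rw [← this] at h₃
    exact_mod_cast h₃
  refine le_trans ?_ h₂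
  calc _ = ∑ S ∈ (Finset.univ : Finset (Fin n)).powersetCard k, (1 / k.factorial : ℝ) *
        prob (fun σ : LBEdge n r s t ≃ Fin (Fintype.card (LBEdge n r s t)) =>
          WellOrdered (fun e => (σ e : ℕ)) z h) := by
        rw [Finset.sum_const, Finset.card_powersetCard, Finset.card_univ, Fintype.card_fin,
          nsmul_eq_mul]
        ring
    _ ≤ _ := by
        refine Finset.sum_le_sum fun S hS => ?_
        have := prob_wellOrdered_le (M := Fintype.card (LBEdge n r s t)) (t := t) hr hs z h S
        rw [(Finset.mem_powersetCard.1 hS).2] at this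
        have hk : (0 : ℝ) < k.factorial := by exact_mod_cast k.factorial_pos
        rw [one_div_mul_eq_div, div_le_iff₀' hk]
        exact this

end LBGraph

/-! ### Asymptotics -/

namespace LBEdge

/-- The edges as a disjoint union. -/
def equivSum : LBEdge n r s t ≃
    ((Fin n × Fin r × Fin s) ⊕ (Fin n × Fin r × Fin s × Fin t)) ⊕
    ((Fin n × Fin (r * s)) ⊕ (Fin n × Fin (r * s) × Fin t)) ⊕
    ((Fin n × Fin t) ⊕ (Fin n × Fin t)) ⊕ ((Fin n × Fin r × Fin t) ⊕ (Fin n × Fin t)) where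
  toFun
    | a1 i j k => .inl (.inl (i, j, k))
    | a0 i j k l => .inl (.inr (i, j, k, l))
    | b1 i j => .inr (.inl (.inl (i, j)))
    | b0 i j l => .inr (.inl (.inr (i, j, l)))
    | u1 i l => .inr (.inr (.inl (.inl (i, l))))
    | u0 i l => .inr (.inr (.inl (.inr (i, l))))
    | w1 i j l => .inr (.inr (.inr (.inl (i, j, l))))
    | w0 i l => .inr (.inr (.inr (.inr (i, l))))
  invFun
    | .inl (.inl (i, j, k)) => a1 i j k
    | .inl (.inr (i, j, k, l)) => a0 i j k l
    | .inr (.inl (.inl (i, j))) => b1 i j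
    | .inr (.inl (.inr (i, j, l))) => b0 i j l
    | .inr (.inr (.inl (.inl (i, l)))) => u1 i l
    | .inr (.inr (.inl (.inr (i, l)))) => u0 i l
    | .inr (.inr (.inr (.inl (i, j, l)))) => w1 i j l
    | .inr (.inr (.inr (.inr (i, l)))) => w0 i l
  left_inv e := by cases e <;> rfl
  right_inv x := by rcases x with (_ | _) | (_ | _) | (_ | _) | (_ | _) <;> rfl

end LBEdge

theorem lbNumEdges_eq (n m : ℕ) :
    lbNumEdges n m m m = n * (2 * m ^ 3 + 3 * m ^ 2 + 3 * m) := by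
  rw [lbNumEdges, Fintype.card_congr LBEdge.equivSum]
  simp only [Fintype.card_sum, Fintype.card_prod, Fintype.card_fin]
  ring

namespace LBGraph

/-- A margin above 1/2 is needed because `M - M / 2` may exceed half of `M` by rounding; `M ≥ 5`
keeps the ratio at most 3/5. -/
theorem three_fifths_le_exp : (3 / 5 : ℝ) ≤ Real.exp (-(1 / 2)) := by
  have h : Real.exp (1 / 2) ≤ 5 / 3 := by
    have h₁ : Real.exp (1 / 2) ^ 2 = Real.exp 1 := by
      rw [← Real.exp_nat_mul]
      norm_num
    have h₂ := Real.exp_one_lt_d9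
    have h₃ := Real.exp_pos (1 / 2)
    nlinarith
  rw [Real.exp_neg, le_inv_comm₀ (by norm_num) (Real.exp_pos _)]
  linarith

theorem prob_not_wellOrdered_le_exp {n m M : ℕ} (hn : 0 < n) (hm : 0 < m)
    (hM : M = lbNumEdges n m m m) [Fintype (LBEdge n m m m ≃ Fin M)] :
    prob (fun σ : LBEdge n m m m ≃ Fin M =>
      ¬ WellOrdered (fun e => (σ e : ℕ)) (M / (2 * m)) (M / 2)) ≤
        11 * m ^ 2 * n * Real.exp (-(1 / 2) * m) := by
  have hM8 : 5 * m ^ 2 ≤ M := by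
    rw [hM, lbNumEdges_eq]
    have h1 : m ^ 2 ≤ m ^ 3 := Nat.pow_le_pow_right hm (by norm_num)
    calc 5 * m ^ 2 ≤ 1 * (2 * m ^ 3 + 3 * m ^ 2 + 3 * m) := by omega
      _ ≤ _ := Nat.mul_le_mul_right _ hn
  have hm1 : (1 : ℝ) ≤ m := by exact_mod_cast hm
  have hm2 : (m : ℝ) ≤ (m : ℝ) ^ 2 := by nlinarith
  have hM' : 5 * (m : ℝ) ^ 2 ≤ M := by exact_mod_cast hM8
  have hM0 : (0 : ℝ) < M := by nlinarith
  have : NeZero M := ⟨by exact_mod_cast hM0.ne'⟩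
  set x := Real.exp (-(1 / 2)) with hx
  have hxm : Real.exp (-(1 / 2) * m) = x ^ m := by rw [hx, ← Real.exp_nat_mul, mul_comm]
  have hx35 := three_fifths_le_exp
  rw [hxm]
  refine (prob_not_wellOrdered_le (Nat.div_le_self _ _) (Nat.div_le_self _ _)).trans ?_
  have hA : (((M / 2 : ℕ) : ℝ) / M) ^ m ≤ x ^ m := by
    refine pow_le_pow_left₀ (by positivity) ?_ m
    have : ((M / 2 : ℕ) : ℝ) ≤ M / 2 := Nat.cast_div_le
    rw [div_le_iff₀ hM0]
    nlinarith
  have hB : (((M - M / 2 : ℕ) : ℝ) / M) ^ m ≤ x ^ m := by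
    refine pow_le_pow_left₀ (by positivity) ?_ m
    have : ((2 * (M - M / 2) : ℕ) : ℝ) ≤ (M + 1 : ℕ) := by
      exact_mod_cast (by omega : 2 * (M - M / 2) ≤ M + 1)
    push_cast at this
    rw [div_le_iff₀ hM0]
    nlinarith
  have hz : ((M / (2 * m) : ℕ) : ℝ) * (2 * m) ≤ M := by
    exact_mod_cast Nat.div_mul_le_self M (2 * m)
  have hz' : (M : ℝ) ≤ (((M / (2 * m) : ℕ) : ℝ) + 1) * (2 * m) := by
    have := (Nat.lt_div_mul_add (a := M) (by omega : 0 < 2 * m)).le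
    have h' : (M : ℝ) ≤ ((M / (2 * m) * (2 * m) + 2 * m : ℕ) : ℝ) := by exact_mod_cast this
    push_cast at h'
    linarith
  -- Here `1 - x ≤ exp (-x)` is used. Rounding `M / (2 m)` down costs at most 1 in the exponent,
  -- hence a factor `e < 3`.
  have hC : (((M - M / (2 * m) : ℕ) : ℝ) / M) ^ (m * m) ≤ 3 * x ^ m := by
    have h₁ : ((M - M / (2 * m) : ℕ) : ℝ) / M ≤ Real.exp (-(((M / (2 * m) : ℕ) : ℝ) / M)) := by
      rw [Nat.cast_sub (Nat.div_le_self _ _), sub_div, div_self hM0.ne']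
      exact Real.one_sub_le_exp_neg _
    refine (pow_le_pow_left₀ (by positivity) h₁ _).trans ?_
    have h₂ : x ^ m * Real.exp 1 ≤ 3 * x ^ m := by
      have := Real.exp_one_lt_d9
      have h0 : 0 < x ^ m := pow_pos (Real.exp_pos _) m
      nlinarith
    refine le_trans ?_ h₂
    rw [← hxm, ← Real.exp_nat_mul, ← Real.exp_add]
    refine Real.exp_le_exp.2 ?_
    push_cast
    have h₃ : (m : ℝ) / 2 - 1 ≤ m * m * (((M / (2 * m) : ℕ) : ℝ) / M) := by
      rw [← mul_div_assoc, le_div_iff₀ hM0]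
      nlinarith
    linarith
  -- The threshold `z ≈ M / (2 m)` makes `m z / M ≤ 1/2`, which compensates the `m ^ m` choice
  -- functions.
  have hD : (m : ℝ) ^ m * (((M / (2 * m) : ℕ) : ℝ) / M) ^ m ≤ x ^ m := by
    rw [← mul_pow]
    refine pow_le_pow_left₀ (by positivity) ?_ m
    rw [← mul_div_assoc, div_le_iff₀ hM0]
    nlinarith
  have hn0 : (0 : ℝ) ≤ n := Nat.cast_nonneg n
  have h0 : 0 ≤ x ^ m := (pow_pos (Real.exp_pos _) m).le
  calc _ ≤ (n * (m * m) + n * (m * m) + n + n + n * m + n) * x ^ m + n * m * x ^ m +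
        n * (3 * x ^ m) + n * x ^ m := by
        rw [mul_assoc (n : ℝ) ((m : ℝ) ^ m)]
        gcongr
    _ = (n * x ^ m) * (2 * m ^ 2 + 2 * m + 7) := by ring
    _ ≤ (n * x ^ m) * (11 * m ^ 2) := by
        refine mul_le_mul_of_nonneg_left ?_ (mul_nonneg hn0 h0)
        nlinarith
    _ = _ := by ring

/-- The number of decreasing subsequences that are expected in a random permutation. -/
theorem exp_le_choose_div_factorial {n : ℕ} (hn : 64 ≤ n) :
    ∃ k, 0 < k ∧ 2 * Real.exp (1 / 4 * Real.sqrt n) ≤ n.choose k / k.factorial := by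
  have h64 : (64 : ℝ) ≤ n := by exact_mod_cast hn
  set q := Real.sqrt n with hq
  have hqq : q * q = n := Real.mul_self_sqrt (by linarith)
  have hq0 : 0 ≤ q := Real.sqrt_nonneg _
  have hq8 : 8 ≤ q := by nlinarith
  -- With this `k` one has `n + 1 - k ≥ 3 k²`, so `n.choose k / k! ≥ ((n + 1 - k) / k²) ^ k ≥ 3 ^
  -- k`. The bound `q ≥ 8` gives `k ≥ 1 + q / 4`, and the spare factor `e` covers the 2 that later
  -- offsets the probability 1/2.
  set k := ⌊q / 2⌋₊ with hkdef
  have hk₁ : (k : ℝ) ≤ q / 2 := Nat.floor_le (by linarith)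
  have hk₂ : q / 2 < k + 1 := Nat.lt_floor_add_one _
  have hk0 : 0 < k := by
    have : (0 : ℝ) < k := by linarith
    exact_mod_cast this
  refine ⟨k, hk0, ?_⟩
  have hkR : (0 : ℝ) < k := by exact_mod_cast hk0
  have hkn : k ≤ n := by
    have : (k : ℝ) ≤ n := by nlinarith
    exact_mod_cast this
  have hfac : (0 : ℝ) < k.factorial := by exact_mod_cast k.factorial_pos
  have hfac' : (k.factorial : ℝ) ≤ (k : ℝ) ^ k := by exact_mod_cast Nat.factorial_le_pow k
  have hsub : 3 * (k : ℝ) ^ 2 ≤ ((n + 1 - k : ℕ) : ℝ) := by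
    rw [Nat.cast_sub (by omega)]
    push_cast
    nlinarith
  have h₁ := Nat.pow_le_choose (α := ℝ) k n
  have h₂ : (3 : ℝ) ^ k ≤ n.choose k / k.factorial := by
    rw [le_div_iff₀ hfac]
    refine le_trans ?_ h₁
    rw [le_div_iff₀ hfac]
    calc (3 : ℝ) ^ k * k.factorial * k.factorial ≤ 3 ^ k * (k : ℝ) ^ k * (k : ℝ) ^ k := by gcongr
      _ = (3 * (k : ℝ) ^ 2) ^ k := by rw [mul_pow, ← pow_mul, mul_assoc, ← pow_add]; ring
      _ ≤ _ := by gcongr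
  refine le_trans ?_ h₂
  have he := Real.exp_one_lt_d9
  have he' := Real.exp_one_gt_d9
  calc 2 * Real.exp (1 / 4 * q) ≤ Real.exp 1 * Real.exp (1 / 4 * q) := by
        gcongr
        linarith
    _ = Real.exp (1 + 1 / 4 * q) := (Real.exp_add _ _).symm
    _ ≤ Real.exp (k * 1) := Real.exp_le_exp.2 (by linarith)
    _ = Real.exp 1 ^ k := Real.exp_nat_mul _ _
    _ ≤ 3 ^ k := by
        gcongr
        linarith

theorem three_mul_log_le {n m : ℕ} (h : 3 * ⌈Real.log n⌉₊ ≤ m) : 3 * Real.log n ≤ m := by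
  have h₁ := Nat.le_ceil (Real.log n)
  have h₂ : ((3 * ⌈Real.log n⌉₊ : ℕ) : ℝ) ≤ m := by exact_mod_cast h
  push_cast at h₂
  linarith

/-- Since `ρ ≥ 3 log n`, the exponential is at most `n ^ (-3/2)`. It outweighs the factor `n` and
leaves `log² n / √n`, up to a constant, which tends to 0. -/
theorem eventually_prob_wellOrdered {ρ : ℕ → ℕ}
    (hρ : (fun n => (ρ n : ℝ)) =O[atTop] fun n : ℕ => Real.log n)
    (hρ_lower : ∀ᶠ n : ℕ in atTop, 3 * ⌈Real.log n⌉₊ ≤ ρ n) :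
    ∀ᶠ n : ℕ in atTop, 11 * (ρ n : ℝ) ^ 2 * n * Real.exp (-(1 / 2) * ρ n) ≤ 1 / 2 := by
  obtain ⟨C, hC, hbound⟩ := hρ.exists_pos
  have hlog : Tendsto (fun n : ℕ => Real.log n / 2) atTop atTop :=
    (Real.tendsto_log_atTop.comp tendsto_natCast_atTop_atTop).atTop_div_const (by norm_num)
  have hlim := ((Real.tendsto_pow_mul_exp_neg_atTop_nhds_zero 2).comp hlog).const_mul (44 * C ^ 2)
  rw [mul_zero] at hlim
  filter_upwards [hbound.bound, hρ_lower, eventually_ge_atTop 1,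
    hlim.eventually_le_const (show (0 : ℝ) < 1 / 2 by norm_num)] with n hle hge hn hsmall
  have hn0 : (0 : ℝ) < n := by exact_mod_cast hn
  have hl0 : 0 ≤ Real.log n := Real.log_natCast_nonneg n
  rw [Real.norm_of_nonneg (Nat.cast_nonneg _), Real.norm_of_nonneg hl0] at hle
  have hge' : 3 * Real.log n ≤ ρ n := three_mul_log_le hge
  refine le_trans ?_ hsmall
  have hexp : n * Real.exp (-(1 / 2) * ρ n) ≤ Real.exp (-(Real.log n / 2)) := by
    calc n * Real.exp (-(1 / 2) * ρ n) = Real.exp (Real.log n + -(1 / 2) * ρ n) := by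
          rw [Real.exp_add, Real.exp_log hn0]
      _ ≤ _ := Real.exp_le_exp.2 (by linarith)
  calc 11 * (ρ n : ℝ) ^ 2 * n * Real.exp (-(1 / 2) * ρ n)
      = 11 * (ρ n : ℝ) ^ 2 * (n * Real.exp (-(1 / 2) * ρ n)) := by ring
    _ ≤ 11 * (C * Real.log n) ^ 2 * Real.exp (-(Real.log n / 2)) := by gcongr
    _ = _ := by
        simp only [Function.comp_apply]
        ring

/-- The edge count has order `n log³ n`, and for large `n` it lies between `n` and `n²`; so `log M`
lies between `log n` and `2 log n`. -/
theorem eventually_sqrt_le {ρ : ℕ → ℕ}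
    (hρ : (fun n => (ρ n : ℝ)) =O[atTop] fun n : ℕ => Real.log n)
    (hρ_lower : ∀ᶠ n : ℕ in atTop, 3 * ⌈Real.log n⌉₊ ≤ ρ n) :
    ∃ C : ℝ, 0 < C ∧ ∀ᶠ n : ℕ in atTop,
      Real.sqrt n ≤ Real.sqrt (lbNumEdges n (ρ n) (ρ n) (ρ n)) /
        Real.log (lbNumEdges n (ρ n) (ρ n) (ρ n)) ^ (3 / 2 : ℝ) ∧
      Real.sqrt (lbNumEdges n (ρ n) (ρ n) (ρ n)) /
        Real.log (lbNumEdges n (ρ n) (ρ n) (ρ n)) ^ (3 / 2 : ℝ) ≤ C * Real.sqrt n := by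
  obtain ⟨C, hC, hbound⟩ := hρ.exists_pos
  refine ⟨Real.sqrt (8 * C ^ 3), by positivity, ?_⟩
  have hcube : (fun n : ℕ => Real.log n ^ 3) =o[atTop] fun n : ℕ => (n : ℝ) :=
    Real.isLittleO_pow_log_id_atTop.comp_tendsto tendsto_natCast_atTop_atTop
  filter_upwards [hbound.bound, hρ_lower, eventually_ge_atTop 3,
    hcube.bound (show 0 < 1 / (8 * C ^ 3) by positivity)] with n hle hge hn hsmall
  have hn0 : (0 : ℝ) < n := by exact_mod_cast (by omega : 0 < n)
  have hl1 : 1 ≤ Real.log n := by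
    rw [Real.le_log_iff_exp_le hn0]
    have := Real.exp_one_lt_d9
    have : (3 : ℝ) ≤ n := by exact_mod_cast hn
    linarith
  rw [Real.norm_of_nonneg (Nat.cast_nonneg _), Real.norm_of_nonneg (by linarith)] at hle
  rw [Real.norm_of_nonneg (by positivity), Real.norm_of_nonneg (by positivity), div_mul_eq_mul_div,
    one_mul, le_div_iff₀ (by positivity)] at hsmall
  have hge' : 3 * Real.log n ≤ ρ n := three_mul_log_le hge
  have hρ1 : (1 : ℝ) ≤ ρ n := by linarith
  have hM : (lbNumEdges n (ρ n) (ρ n) (ρ n) : ℝ) =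
      n * (2 * (ρ n : ℝ) ^ 3 + 3 * (ρ n : ℝ) ^ 2 + 3 * ρ n) := by
    rw [lbNumEdges_eq]
    push_cast
    rfl
  set M : ℝ := (lbNumEdges n (ρ n) (ρ n) (ρ n) : ℝ) with hMdef
  have hρ2 : (ρ n : ℝ) ≤ (ρ n : ℝ) ^ 3 := le_self_pow₀ hρ1 (by norm_num)
  have hρ3 : (ρ n : ℝ) ^ 2 ≤ (ρ n : ℝ) ^ 3 := pow_le_pow_right₀ hρ1 (by norm_num)
  have hMupper : M ≤ 8 * C ^ 3 * Real.log n ^ 3 * n := by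
    calc M ≤ n * (8 * (ρ n : ℝ) ^ 3) := by
          rw [hM]
          refine mul_le_mul_of_nonneg_left ?_ hn0.le
          linarith
      _ ≤ n * (8 * (C * Real.log n) ^ 3) := by gcongr
      _ = _ := by ring
  have hMlower : 8 * Real.log n ^ 3 * n ≤ M := by
    calc 8 * Real.log n ^ 3 * n ≤ n * (2 * (3 * Real.log n) ^ 3) := by
          have : 0 ≤ Real.log n ^ 3 * n := by positivity
          nlinarith
      _ ≤ n * (2 * (ρ n : ℝ) ^ 3) := by gcongr
      _ ≤ M := by
          rw [hM]
          refine mul_le_mul_of_nonneg_left ?_ hn0.le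
          nlinarith
  have hnM : (n : ℝ) ≤ M := by
    refine le_trans ?_ hMlower
    have : 1 ≤ Real.log n ^ 3 := one_le_pow₀ hl1
    nlinarith
  have hM0 : 0 < M := hn0.trans_le hnM
  have hL₁ : Real.log n ≤ Real.log M := Real.log_le_log hn0 hnM
  have hL₂ : Real.log M ≤ 2 * Real.log n := by
    have : M ≤ (n : ℝ) ^ 2 := by
      refine hMupper.trans ?_
      nlinarith
    refine (Real.log_le_log hM0 this).trans ?_
    rw [Real.log_pow]
    norm_num
  have hL0 : 0 < Real.log M := by linarith
  have hrpow : Real.log M ^ (3 / 2 : ℝ) = Real.sqrt (Real.log M ^ 3) := by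
    rw [Real.sqrt_eq_rpow, ← Real.rpow_natCast, ← Real.rpow_mul hL0.le]
    norm_num
  rw [hrpow, ← Real.sqrt_div hM0.le, ← Real.sqrt_mul (by positivity)]
  constructor
  · refine Real.sqrt_le_sqrt ?_
    rw [le_div_iff₀ (by positivity)]
    refine le_trans ?_ hMlower
    have : Real.log M ^ 3 ≤ (2 * Real.log n) ^ 3 := by gcongr
    calc (n : ℝ) * Real.log M ^ 3 ≤ n * (2 * Real.log n) ^ 3 := by gcongr
      _ = _ := by ring
  · refine Real.sqrt_le_sqrt ?_
    rw [div_le_iff₀ (by positivity)]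
    refine hMupper.trans ?_
    calc 8 * C ^ 3 * Real.log n ^ 3 * n = 8 * C ^ 3 * n * Real.log n ^ 3 := by ring
      _ ≤ _ := by gcongr

end LBGraph

end LowerBound

/-! ### Combination of the counting, probability and asymptotic bounds. -/

theorem mainTheorem2 (ρ : ℕ → ℕ)
    (hρ : (fun n => (ρ n : ℝ)) =Θ[atTop] fun n : ℕ => Real.log n)
    (hρ_lower : ∀ᶠ n : ℕ in atTop, 3 * ⌈Real.log n⌉₊ ≤ ρ n) :
    ((fun n : ℕ => Real.sqrt n) =Θ[atTop] fun n : ℕ =>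
      Real.sqrt (lbNumEdges n (ρ n) (ρ n) (ρ n)) /
        Real.log (lbNumEdges n (ρ n) (ρ n) (ρ n)) ^ (3 / 2 : ℝ)) ∧
    ∃ c : ℝ, 0 < c ∧ ∀ᶠ n : ℕ in atTop,
      ∀ B₀ : Finset (LBEdge n (ρ n) (ρ n) (ρ n)),
        (lbGraph n (ρ n) (ρ n) (ρ n)).IsTree B₀ → (∀ e ∈ B₀, e.IsZeroEdge) →
        Real.exp (c * Real.sqrt n) ≤
            (lbGraph n (ρ n) (ρ n) (ρ n)).expectedSwitches B₀ ∧
        Real.exp (c * (Real.sqrt (lbNumEdges n (ρ n) (ρ n) (ρ n)) /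
              Real.log (lbNumEdges n (ρ n) (ρ n) (ρ n)) ^ (3 / 2 : ℝ))) ≤
            (lbGraph n (ρ n) (ρ n) (ρ n)).expectedSwitches B₀ := by
  classical
  obtain ⟨C, hC, hMC⟩ := LBGraph.eventually_sqrt_le hρ.1 hρ_lower
  -- The exponent obtained is `√n / 4`; the second constant converts it through `√M / log^{3/2} M ≤
  -- C √n`.
  refine ⟨⟨?_, ?_⟩, min (1 / 4) (1 / (4 * C)), by positivity, ?_⟩
  · refine IsBigO.of_bound 1 ?_
    filter_upwards [hMC] with n hn
    rw [Real.norm_of_nonneg (Real.sqrt_nonneg _), one_mul]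
    exact hn.1.trans (le_abs_self _)
  · refine IsBigO.of_bound C ?_
    filter_upwards [hMC] with n hn
    rw [Real.norm_of_nonneg (Real.sqrt_nonneg _), Real.norm_of_nonneg]
    · exact hn.2
    · exact (Real.sqrt_nonneg _).trans hn.1
  filter_upwards [hMC, LBGraph.eventually_prob_wellOrdered hρ.1 hρ_lower, hρ_lower,
    eventually_ge_atTop 64] with n hMn hprob hρn hn B₀ hB₀ hzero
  have hlog : 0 < Real.log n := Real.log_pos (by exact_mod_cast (by omega : 1 < n))
  have hρ0 : 0 < ρ n := by
    have := Nat.ceil_pos.2 hlog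
    omega
  obtain ⟨k, hk, hexp⟩ := LBGraph.exp_le_choose_div_factorial hn
  have hle := LBGraph.le_expectedSwitches (z := lbNumEdges n (ρ n) (ρ n) (ρ n) / (2 * ρ n))
    (h := lbNumEdges n (ρ n) (ρ n) (ρ n) / 2) hρ0 hρ0
    (Nat.div_le_div_left (by omega) (by norm_num)) hk hB₀ hzero
  have hnot := (LBGraph.prob_not_wellOrdered_le_exp (n := n) (by omega) hρ0 rfl).trans hprob
  have : Nonempty (LBEdge n (ρ n) (ρ n) (ρ n) ≃ Fin (lbNumEdges n (ρ n) (ρ n) (ρ n))) :=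
    ⟨Fintype.equivFin _⟩
  have hge := one_le_prob_add_prob_not
    (fun σ : LBEdge n (ρ n) (ρ n) (ρ n) ≃ Fin (lbNumEdges n (ρ n) (ρ n) (ρ n)) =>
      LBGraph.WellOrdered (fun e => (σ e : ℕ)) (lbNumEdges n (ρ n) (ρ n) (ρ n) / (2 * ρ n))
        (lbNumEdges n (ρ n) (ρ n) (ρ n) / 2))
  have hmain : Real.exp (1 / 4 * Real.sqrt n) ≤
      (lbGraph n (ρ n) (ρ n) (ρ n)).expectedSwitches B₀ := by
    refine le_trans ?_ hle
    change _ ≤ _ * prob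
      (fun σ : LBEdge n (ρ n) (ρ n) (ρ n) ≃ Fin (lbNumEdges n (ρ n) (ρ n) (ρ n)) => _)
    have hP : (1 / 2 : ℝ) ≤ prob
      (fun σ : LBEdge n (ρ n) (ρ n) (ρ n) ≃ Fin (lbNumEdges n (ρ n) (ρ n) (ρ n)) =>
        LBGraph.WellOrdered (fun e => (σ e : ℕ)) (lbNumEdges n (ρ n) (ρ n) (ρ n) / (2 * ρ n))
          (lbNumEdges n (ρ n) (ρ n) (ρ n) / 2)) := by linarith
    refine le_trans ?_ (mul_le_mul hexp hP (by norm_num) (by positivity))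
    linarith
  refine ⟨le_trans (Real.exp_le_exp.2 ?_) hmain, le_trans (Real.exp_le_exp.2 ?_) hmain⟩
  · exact mul_le_mul_of_nonneg_right (min_le_left _ _) (Real.sqrt_nonneg _)
  · calc _ ≤ 1 / (4 * C) * (C * Real.sqrt n) :=
          mul_le_mul (min_le_right _ _) hMn.2 ((Real.sqrt_nonneg _).trans hMn.1) (by positivity)
      _ = 1 / 4 * Real.sqrt n := by field_simp
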